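/- Let $n>1$, $d\ge 2$ and $t$ be integers with $\gcd(t,d)=1$, $n\equiv t \pmod d$ and $n+d-nd\le t\le n$. Let $q$ be an indeterminate; for an integer $m$ put $[m]=(1-q^m)/(1-q)$ and $[m]_{q^2}=(1-q^{2m})/(1-q^2)$, let $(a;x)_k=(1-a)(1-ax)\cdots(1-ax^{k-1})$, and let $\Phi_n$ be the $n$-th cyclotomic polynomial. For rational functions $A,B\in\mathbb{Q}(q)$ and a polynomial $P\in\mathbb{Q}[q]$, write $A\equiv B\pmod P$ if $A-B$ is a quotient of two polynomials whose numerator is divisible by $P$ and whose denominator is non-zero and relatively prime to $P$. Then, for both $M=(n-t)/d$ and $M=n-1$, $$\sum_{k=0}^{M}[2dk+t]_{q^2}[2dk+t]^2\frac{(q^{2t};q^{2d})_k^4}{(q^{2d};q^{2d})_k^4}\,q^{-4tk}\equiv \frac{-2[t]^2[n]_{q^2}(q^{4t};q^{2d})_{(n-t)/d}}{(1+q^{2t})(q^{2d};q^{2d})_{(n-t)/d}}\,q^{t-2t(n-t)/d}\pmod{[n]_{q^2}\Phi_n(q^2)^2}.$$ -/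

import Mathlib

open Polynomial

noncomputable section

/-- The `q`-integer `[m]_q = (1 - q ^ m) / (1 - q)`, for an arbitrary integer `m`. -/
def qInt {K : Type*} [Field K] (q : K) (m : ℤ) : K :=
  (1 - q ^ m) / (1 - q)

/-- The `q`-shifted factorial `(a; q)_k = (1 - a) (1 - a q) ⋯ (1 - a q ^ (k - 1))`. -/
def qPoch {K : Type*} [Field K] (a q : K) (k : ℕ) : K :=
  ∏ j ∈ Finset.range k, (1 - a * q ^ j)

/-- Congruence of rational functions modulo a polynomial `P`: the difference `A - B` can be
written as a fraction whose numerator is divisible by `P` and whose denominator is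
relatively prime to `P`. -/
def QCongr (P : ℚ[X]) (A B : RatFunc ℚ) : Prop :=
  ∃ u v : ℚ[X], v ≠ 0 ∧ IsCoprime v P ∧
    A - B = algebraMap ℚ[X] (RatFunc ℚ) (P * u) / algebraMap ℚ[X] (RatFunc ℚ) v

/-- The polynomial `[n]_{q^2} = 1 + q ^ 2 + ⋯ + q ^ (2 (n - 1))`. -/
def qIntSqPoly (n : ℕ) : ℚ[X] :=
  ∑ i ∈ Finset.range n, (X ^ 2) ^ i

/-- As a rational function, `qIntSqPoly n` is the `q`-integer `[n]` in base `q ^ 2`. -/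
theorem algebraMap_qIntSqPoly (n : ℕ) :
    algebraMap ℚ[X] (RatFunc ℚ) (qIntSqPoly n) = qInt ((RatFunc.X : RatFunc ℚ) ^ 2) n := by
  have h : (1 - (RatFunc.X : RatFunc ℚ) ^ 2) ≠ 0 := by
    have h0 : (1 - X ^ 2 : ℚ[X]) ≠ 0 := by
      intro h
      have := congrArg (Polynomial.eval 0) h
      simp at this
    have h1 := (map_ne_zero_iff (algebraMap ℚ[X] (RatFunc ℚ))
      (RatFunc.algebraMap_injective ℚ)).mpr h0
    simpa using h1
  rw [qInt, eq_div_iff h, qIntSqPoly, map_sum]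
  simp only [map_pow, RatFunc.algebraMap_X, zpow_natCast]
  exact geom_sum_mul_neg _ n

/-- The modulus `[n]_{q^2} Φ_n(q^2)^2`, where `Φ_n` is the `n`-th cyclotomic polynomial. -/
def qModulus (n : ℕ) : ℚ[X] :=
  qIntSqPoly n * ((cyclotomic n ℚ).comp (X ^ 2)) ^ 2

/-- The summand
`[2dk+t]_{q^2} [2dk+t]^2 (q^{2t}; q^{2d})_k^4 / (q^{2d}; q^{2d})_k^4 * q^{-4tk}`. -/
def summand {K : Type*} [Field K] (q : K) (d : ℕ) (t : ℤ) (k : ℕ) : K :=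
  qInt (q ^ 2) (2 * d * k + t) * qInt q (2 * d * k + t) ^ 2 *
    (qPoch (q ^ (2 * t)) (q ^ (2 * d)) k ^ 4 / qPoch (q ^ (2 * d)) (q ^ (2 * d)) k ^ 4) *
    q ^ (-4 * t * k)

/-- The closed form
`-2 [t]^2 [n]_{q^2} (q^{4t}; q^{2d})_N q^{t-2tN} / ((1 + q^{2t}) (q^{2d}; q^{2d})_N)`,
to be used with `N = (n - t) / d`. -/
def closedForm {K : Type*} [Field K] (q : K) (n d : ℕ) (t : ℤ) (N : ℕ) : K :=
  (-2 * qInt q t ^ 2 * qInt (q ^ 2) n * qPoch (q ^ (4 * t)) (q ^ (2 * d)) N) /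
    ((1 + q ^ (2 * t)) * qPoch (q ^ (2 * d)) (q ^ (2 * d)) N) * q ^ (t - 2 * t * N)

end

/-! ### A terminating very-well-poised `₆φ₅` sum by a Wilf–Zeilberger pair -/

section SixPhiFive

variable {K : Type*} [Field K]

/-! Since `[n]_{q^2}` is the product of `Φ_m(q^2)` over `m ∣ n`, `m > 1`, the modulus is
`Φ_n(q^2)^3` times the remaining `Φ_m(q^2)`, all pairwise coprime. So it suffices to work in the
localization of `ℚ[q]` at each `Φ_m(q^2)`, where `1 - q^(2m)` generates the ideal of `Φ_m(q^2)`.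

Put `σ(L) = (q^L - q^(-L))^2`. Up to a factor independent of `k`, the summand is `c_k = p(2dk + t)
r_k^2`, where `p` is odd and `r_k = ∏_{j<k} σ(t + dj) / σ(d(j+1))`. Modulo `Φ_m(q^2)`, `σ(L)`
depends only on `L` mod `m` and `p(L)` only on `L` mod `2m`. Let `0 ≤ s < m` with `m ∣ t + ds`. Then
`c_k + c_{s-k} ≡ 0` for `k ≤ s`, and `c_k ≡ 0` for `s < k < m` because `σ(t + ds)` occurs in `r_k`.
Later blocks of length `m` are multiples of the first. Hence both truncated sums vanish modulo each
`Φ_m(q^2)`, and so does the closed form, through `[n]_{q^2}` (`sum_coreTerm_of_dvd`,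
`sum_coreTerm_mul`, `closedForm_cong_zero`).

For the cube take `m = n`, `s = N = (n - t)/d`, and in one of the two factors `r_k` replace every
`σ(L)` by `σ(L) - σ(n)`. This multiplies `c_k` by some `ρ_k` with `ρ_k ≡ 1` mod `Φ_n(q^2)^2` and
`ρ_k ≡ ρ_{N-k}` mod `Φ_n(q^2)^3`; with the antisymmetry of `c_k`, the sum is unchanged modulo the
cube (`sum_coreTerm_cong_deformed`). The deformed sum is a combination of two summable `₆φ₅` series,
and equals the closed form plus a multiple of `(1 - q^(2n))^3` (`sum_symmRatio`,
`coeff_mul_sum_deformed`). -/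

theorem qPoch_zero (a q : K) : qPoch a q 0 = 1 := by simp [qPoch]

theorem qPoch_succ (a q : K) (k : ℕ) : qPoch a q (k + 1) = qPoch a q k * (1 - a * q ^ k) :=
  Finset.prod_range_succ _ _

theorem qPoch_succ' (a q : K) (k : ℕ) : qPoch a q (k + 1) = (1 - a) * qPoch (a * q) q k := by
  rw [qPoch, Finset.prod_range_succ', mul_comm, qPoch]
  congr 1
  · simp
  · refine Finset.prod_congr rfl fun j _ => ?_
    ring

theorem qPoch_ne_zero {a q : K} {k : ℕ} (h : ∀ j < k, a * q ^ j ≠ 1) : qPoch a q k ≠ 0 :=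
  Finset.prod_ne_zero_iff.mpr fun j hj =>
    sub_ne_zero.mpr (h j (Finset.mem_range.mp hj)).symm

/-- The `k`-th term of the terminating very-well-poised `₆φ₅` series with parameters
`a; a, e, P ^ (-N)` in base `P`. -/
def sixPhiFiveTerm (a e P : K) (N k : ℕ) : K :=
  (1 - a * P ^ (2 * k)) * qPoch a P k ^ 2 * qPoch e P k * qPoch (P ^ N)⁻¹ P k /
    (qPoch P P k ^ 2 * qPoch (a * P / e) P k * qPoch (a * P ^ (N + 1)) P k) *
    (P ^ (N + 1) / e) ^ k

/-- The antidifference, in the summation index, of the Wilf–Zeilberger pair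
attached to `sixPhiFiveTerm`. -/
def sixPhiFiveCert (a e P : K) (N k : ℕ) : K :=
  P ^ (N + 1) / e / ((1 - P ^ (N + 1)) * (1 - a * P ^ (N + 1) / e)) *
    (qPoch a P (k + 1) ^ 2 * qPoch e P (k + 1) * qPoch (P ^ N)⁻¹ P k /
      (qPoch P P k ^ 2 * qPoch (a * P / e) P k * qPoch (a * P ^ (N + 2)) P k)) *
    (P ^ (N + 1) / e) ^ k

/-- The coefficient is the ratio of consecutive values in `N` of the expected product formula. Each
difference is `G(k) - G(k-1)` with `G` the certificate, so the partial sums telescope. -/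
theorem sixPhiFiveTerm_sub_eq_cert {a e P : K} (he : e ≠ 0) (hP0 : P ≠ 0)
    (hP : ∀ j : ℕ, P ^ (j + 1) ≠ 1) (haP : ∀ j : ℕ, a * P ^ (j + 1) ≠ 1)
    (hae : ∀ j : ℕ, a * P ^ (j + 1) / e ≠ 1) (N M : ℕ) :
    ∑ k ∈ Finset.range (M + 1), (sixPhiFiveTerm a e P (N + 1) k -
      (1 - a * P ^ (N + 1)) * (1 - P ^ (N + 1) / e) /
        ((1 - P ^ (N + 1)) * (1 - a * P ^ (N + 1) / e)) * sixPhiFiveTerm a e P N k) =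
      sixPhiFiveCert a e P N M := by
  have hw : 1 - P ^ (N + 1) ≠ 0 := sub_ne_zero.mpr (hP N).symm
  have hx : e - a * P ^ (N + 1) ≠ 0 := by
    have := hae N
    rw [Ne, div_eq_one_iff_eq he] at this
    exact sub_ne_zero.mpr (Ne.symm this)
  have hx' : 1 - a * P ^ (N + 1) / e ≠ 0 := sub_ne_zero.mpr (hae N).symm
  induction M with
  | zero =>
    simp only [sixPhiFiveTerm, sixPhiFiveCert, zero_add, Finset.sum_range_one, qPoch_zero,
      qPoch_succ, pow_zero, mul_zero]
    field_simp
    ring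
  | succ M ih =>
    rw [Finset.sum_range_succ, ih]
    have e1 : qPoch (P ^ (N + 1))⁻¹ P (M + 1) =
        (1 - (P ^ (N + 1))⁻¹) * qPoch (P ^ N)⁻¹ P M := by
      rw [qPoch_succ']
      congr 2
      field_simp
      ring
    have e2 : qPoch (a * P ^ (N + 1)) P (M + 1) =
        (1 - a * P ^ (N + 1)) * qPoch (a * P ^ (N + 2)) P M := by
      rw [qPoch_succ']
      congr 2
      ring
    have e3 : (P ^ (N + 1 + 1) / e) ^ (M + 1) = (P ^ (N + 1) / e) ^ M * (P ^ (N + 1) / e)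
        * (P ^ M * P) := by
      rw [pow_succ P (N + 1), mul_div_right_comm, mul_pow]
      ring
    have h1 : qPoch P P M ≠ 0 := qPoch_ne_zero fun j _ => by
      rw [← pow_succ']; exact hP j
    have h2 : qPoch (a * P / e) P M ≠ 0 := qPoch_ne_zero fun j _ => by
      have := hae j
      rwa [show a * P / e * P ^ j = a * P ^ (j + 1) / e by ring]
    have h3 : qPoch (a * P ^ (N + 2)) P M ≠ 0 := qPoch_ne_zero fun j _ => by
      have := haP (N + 1 + j)
      rwa [mul_assoc, ← pow_add, show N + 2 + j = N + 1 + j + 1 by ring]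
    have g1 : 1 - P * P ^ M ≠ 0 := by
      rw [← pow_succ']; exact sub_ne_zero.mpr (hP M).symm
    have g2 : e - a * P * P ^ M ≠ 0 := by
      have := hae M
      rw [Ne, div_eq_one_iff_eq he] at this
      rw [mul_assoc, ← pow_succ']
      exact sub_ne_zero.mpr (Ne.symm this)
    have g2' : 1 - a * P / e * P ^ M ≠ 0 := by
      rw [show 1 - a * P / e * P ^ M = (e - a * P * P ^ M) / e by field_simp]
      exact div_ne_zero g2 he
    have g3 : 1 - a * P ^ (N + 2) * P ^ M ≠ 0 := by
      have := haP (N + 1 + M)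
      rw [mul_assoc, ← pow_add, show N + 2 + M = N + 1 + M + 1 by ring]
      exact sub_ne_zero.mpr this.symm
    have g4 : 1 - a * P ^ (N + 1) ≠ 0 := sub_ne_zero.mpr (haP N).symm
    simp only [sixPhiFiveTerm, sixPhiFiveCert, e1, e2, e3, show N + 1 + 1 = N + 2 from rfl]
    rw [qPoch_succ a P (M + 1), qPoch_succ e P (M + 1), qPoch_succ P P M,
      qPoch_succ (a * P / e) P M, qPoch_succ (a * P ^ (N + 2)) P M,
      qPoch_succ (P ^ N)⁻¹ P M, pow_succ (P ^ (N + 1) / e) M,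
      show P ^ (2 * (M + 1)) = (P ^ M) ^ 2 * P ^ 2 by ring]
    generalize qPoch a P (M + 1) = A
    generalize qPoch e P (M + 1) = E
    generalize qPoch (P ^ N)⁻¹ P M = F
    generalize (P ^ (N + 1) / e) ^ M = Z
    generalize qPoch P P M = Q at *
    generalize qPoch (a * P / e) P M = R at *
    generalize qPoch (a * P ^ (N + 2)) P M = S at *
    simp only [pow_succ P M, pow_succ P N, show P ^ (N + 2) = P ^ N * P ^ 2 by ring] at *
    have hu : P ^ M ≠ 0 := pow_ne_zero _ hP0
    have hv : P ^ N ≠ 0 := pow_ne_zero _ hP0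
    generalize P ^ M = u at *
    generalize P ^ N = v at *
    have hg : e⁻¹ ≠ 0 := inv_ne_zero he
    have hge : e * e⁻¹ = 1 := mul_inv_cancel₀ he
    simp only [div_eq_mul_inv _ e] at *
    generalize e⁻¹ = g at *
    -- Opaque names for the denominators let them be cleared as atoms; what remains is a polynomial
    -- identity modulo `e * g = 1`.
    obtain ⟨D₁, hD₁⟩ : ∃ D, D = 1 - v * P := ⟨_, rfl⟩
    obtain ⟨D₂, hD₂⟩ : ∃ D, D = 1 - a * (v * P) * g := ⟨_, rfl⟩
    obtain ⟨D₃, hD₃⟩ : ∃ D, D = 1 - P * u := ⟨_, rfl⟩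
    obtain ⟨D₄, hD₄⟩ : ∃ D, D = 1 - a * P * g * u := ⟨_, rfl⟩
    obtain ⟨D₅, hD₅⟩ : ∃ D, D = 1 - a * (v * P ^ 2) * u := ⟨_, rfl⟩
    obtain ⟨D₆, hD₆⟩ : ∃ D, D = 1 - a * (v * P) := ⟨_, rfl⟩
    rw [← hD₁] at hw
    rw [← hD₂] at hx'
    rw [← hD₃] at g1
    rw [← hD₄] at g2'
    rw [← hD₅] at g3
    rw [← hD₆] at g4
    simp only [← hD₁, ← hD₂, ← hD₃, ← hD₄, ← hD₅, ← hD₆]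
    clear e1 e2 e3 ih hP haP hae
    field_simp
    rw [hD₁, hD₂, hD₃, hD₄, hD₅]
    linear_combination (v * P * A ^ 2 * E * F * Z * (v - u) * (1 - P * a * u) ^ 2 * P * u) * hge

theorem sum_sixPhiFiveTerm {a e P : K} (he : e ≠ 0) (hP0 : P ≠ 0)
    (hP : ∀ j : ℕ, P ^ (j + 1) ≠ 1) (haP : ∀ j : ℕ, a * P ^ (j + 1) ≠ 1)
    (hae : ∀ j : ℕ, a * P ^ (j + 1) / e ≠ 1) (N : ℕ) :
    ∑ k ∈ Finset.range (N + 1), sixPhiFiveTerm a e P N k =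
      (1 - a) * qPoch (a * P) P N * qPoch (P / e) P N /
        (qPoch P P N * qPoch (a * P / e) P N) := by
  induction N with
  | zero => simp [sixPhiFiveTerm, qPoch_zero]
  | succ N ih =>
    -- This zero kills both the certificate at `k = N + 1` and the extra term `k = N + 1` of the
    -- series for `N`.
    have hvan : qPoch (P ^ N)⁻¹ P (N + 1) = 0 := by
      rw [qPoch_succ, inv_mul_cancel₀ (pow_ne_zero _ hP0), sub_self, mul_zero]
    have h := sixPhiFiveTerm_sub_eq_cert he hP0 hP haP hae N (N + 1)
    rw [Finset.sum_sub_distrib, ← Finset.mul_sum,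
      Finset.sum_range_succ (sixPhiFiveTerm a e P N), ih] at h
    simp only [sixPhiFiveCert, sixPhiFiveTerm, hvan, mul_zero, zero_div, zero_mul,
      add_zero] at h
    simp only [sixPhiFiveTerm]
    rw [sub_eq_zero.mp h, qPoch_succ (a * P), qPoch_succ (P / e), qPoch_succ P,
      qPoch_succ (a * P / e), div_mul_div_comm]
    rw [show a * P * P ^ N = a * P ^ (N + 1) by ring, show P * P ^ N = P ^ (N + 1) by ring,
      show a * P / e * P ^ N = a * P ^ (N + 1) / e by ring,
      show P / e * P ^ N = P ^ (N + 1) / e by ring]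
    congr 1 <;> ring

end SixPhiFive

/-! ### Evaluation of the deformed sum -/

section DeformedSum

variable {K : Type*} [Field K]

/-- The ratio of symmetrized `q`-shifted factorials
`∏_{j<k} (u_j + u_j⁻¹ - c) / (w_j + w_j⁻¹ - c)` with `u_j = a P ^ j` and `w_j = P ^ (j + 1)`. -/
def symmRatio (a P c : K) (k : ℕ) : K :=
  ∏ j ∈ Finset.range k, (a * P ^ j + (a * P ^ j)⁻¹ - c) / (P ^ (j + 1) + (P ^ (j + 1))⁻¹ - c)

theorem add_inv_sub_add_inv {u y : K} (hu : u ≠ 0) (hy : y ≠ 0) :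
    u + u⁻¹ - (y + y⁻¹) = (1 - u * y) * (1 - u / y) / u := by
  field_simp
  ring

theorem symmRatio_add_inv {a P y : K} (ha : a ≠ 0) (hP : P ≠ 0) (hy : y ≠ 0) (k : ℕ) :
    symmRatio a P (y + y⁻¹) k = qPoch (a * y) P k * qPoch (a / y) P k /
      (qPoch (P * y) P k * qPoch (P / y) P k) * (P / a) ^ k := by
  induction k with
  | zero => simp [symmRatio, qPoch_zero]
  | succ k ih =>
    have hPk : P ^ k ≠ 0 := pow_ne_zero _ hP
    rw [symmRatio, Finset.prod_range_succ, ← symmRatio, ih,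
      add_inv_sub_add_inv (mul_ne_zero ha hPk) hy,
      add_inv_sub_add_inv (pow_ne_zero _ hP) hy, qPoch_succ, qPoch_succ, qPoch_succ, qPoch_succ]
    rw [show a * P ^ k * y = a * y * P ^ k by ring, show a * P ^ k / y = a / y * P ^ k by ring,
      show P ^ (k + 1) * y = P * y * P ^ k by ring, show P ^ (k + 1) / y = P / y * P ^ k by ring,
      pow_succ (P / a), pow_succ P, div_div_div_eq]
    have : P ^ k * P / (a * P ^ k) = P / a := by field_simp
    rw [← this]
    simp only [div_eq_mul_inv, mul_inv]
    ring

theorem qPoch_inv_mul {b P : K} (hb : b ≠ 0) (hP : P ≠ 0) (N : ℕ) :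
    qPoch (P / (b * P ^ N)) P N = qPoch b P N * ∏ i ∈ Finset.range N, (-(b * P ^ i)⁻¹) := by
  rw [qPoch, ← Finset.prod_range_reflect, qPoch, ← Finset.prod_mul_distrib]
  refine Finset.prod_congr rfl fun i hi => ?_
  have hi' := Finset.mem_range.mp hi
  obtain ⟨l, rfl⟩ : ∃ l, N = i + 1 + l := ⟨N - (i + 1), by omega⟩
  rw [show i + 1 + l - 1 - i = l by omega]
  have h1 : P ^ i ≠ 0 := pow_ne_zero _ hP
  have h2 : P ^ l ≠ 0 := pow_ne_zero _ hP
  rw [pow_add, pow_add]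
  field_simp
  ring

theorem qPoch_inv_div {a P : K} (ha : a ≠ 0) (hP : P ≠ 0) (b : K) (hb : b ≠ 0) (N : ℕ) :
    qPoch (P / (a * b * P ^ N)) P N / qPoch (P / (b * P ^ N)) P N =
      qPoch (a * b) P N / qPoch b P N * a⁻¹ ^ N := by
  rw [qPoch_inv_mul (mul_ne_zero ha hb) hP, qPoch_inv_mul hb hP, mul_div_mul_comm,
    ← Finset.prod_div_distrib]
  congr 1
  rw [Finset.prod_congr rfl (g := fun _ => a⁻¹), Finset.prod_const, Finset.card_range]
  intro i _
  have h1 : P ^ i ≠ 0 := pow_ne_zero _ hP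
  field_simp

/-- The left side is the `₆φ₅` term with `e = a y` times `(1 - s P^k)^2 / P^k`. That factor differs
from `(1 - a y P^k)(1 - P^k / y) / P^k` by a constant in `k`, and multiplying by the latter shifts
`e` from `a y` to `a y P`. -/
theorem symmRatio_term_eq {s a y P : K} {N : ℕ} (hs : s ≠ 0) (ha : a = s ^ 2) (hP0 : P ≠ 0)
    (hy : y = a * P ^ N) (hy1 : ∀ j : ℕ, P ^ j ≠ y) (k : ℕ) :
    (1 - (s * P ^ k) ^ 2) * (1 - s * P ^ k) ^ 2 / (P ^ k) ^ 2 *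
        symmRatio a P 2 k * symmRatio a P (y + y⁻¹) k =
      (1 - a * y) * (1 - y⁻¹) * sixPhiFiveTerm a (a * y * P) P N k +
        (a * y + y⁻¹ - 2 * s) * sixPhiFiveTerm a (a * y) P N k := by
  have ha0 : a ≠ 0 := ha ▸ pow_ne_zero _ hs
  have hPN : P ^ N ≠ 0 := pow_ne_zero _ hP0
  have hy0 : y ≠ 0 := hy ▸ mul_ne_zero ha0 hPN
  have h2 := symmRatio_add_inv ha0 hP0 one_ne_zero k
  rw [inv_one, one_add_one_eq_two] at h2
  simp only [mul_one, div_one] at h2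
  have hPk : P ^ k ≠ 0 := pow_ne_zero _ hP0
  have hk1 : 1 - P ^ k / y ≠ 0 := by
    rw [Ne, sub_eq_zero, eq_comm, div_eq_one_iff_eq hy0]
    exact hy1 _
  have hk2 : y - P ^ k ≠ 0 := sub_ne_zero.mpr (hy1 k).symm
  have h10 : 1 - y⁻¹ ≠ 0 := fun h =>
    hy1 0 (by rw [pow_zero, ← inv_inv y, ← sub_eq_zero.mp h, inv_one])
  have f1 : (1 - a * y) * qPoch (a * y * P) P k = qPoch (a * y) P k * (1 - a * y * P ^ k) := by
    rw [← qPoch_succ', qPoch_succ]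
  have f2 : qPoch (P / y) P k = qPoch y⁻¹ P k * (1 - P ^ k / y) / (1 - y⁻¹) := by
    rw [eq_div_iff h10, mul_comm, show P / y = y⁻¹ * P by field_simp, ← qPoch_succ',
      qPoch_succ]
    congr 2
    field_simp
  have g1 : (P ^ N)⁻¹ = a / y := by rw [hy]; field_simp
  have g2 : a * P ^ (N + 1) = P * y := by rw [hy]; ring
  have g3 : P ^ (N + 1) / (a * y) = P / a / a := by rw [hy]; field_simp; ring
  have g4 : P ^ (N + 1) / (a * y * P) = P / a / a / P := by rw [hy]; field_simp; ring
  have g5 : a * P / (a * y) = P / y := by field_simp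
  have g6 : a * P / (a * y * P) = y⁻¹ := by field_simp
  have t2 : (1 - a * y) * (1 - y⁻¹) * sixPhiFiveTerm a (a * y * P) P N k =
      (1 - a * y * P ^ k) * (1 - P ^ k / y) / P ^ k * sixPhiFiveTerm a (a * y) P N k := by
    simp only [sixPhiFiveTerm, g1, g2, g3, g4, g5, g6]
    calc _ = (1 - y⁻¹) * ((1 - a * P ^ (2 * k)) * qPoch a P k ^ 2 *
          ((1 - a * y) * qPoch (a * y * P) P k) * qPoch (a / y) P k /
        (qPoch P P k ^ 2 * qPoch y⁻¹ P k * qPoch (P * y) P k) * (P / a / a / P) ^ k) := by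
          ring
      _ = _ := by
        rw [f1, f2, div_pow _ P]
        field_simp
  rw [t2, h2, symmRatio_add_inv ha0 hP0 hy0]
  simp only [sixPhiFiveTerm, g1, g2, g3, g5]
  have hX : (1 - s * P ^ k) ^ 2 / P ^ k =
      (1 - a * y * P ^ k) * (1 - P ^ k / y) / P ^ k + (a * y + y⁻¹ - 2 * s) := by
    rw [ha]
    field_simp
    ring
  rw [← add_mul, ← hX, show a * P ^ (2 * k) = (s * P ^ k) ^ 2 by rw [ha]; ring, div_pow (P / a),
    div_pow P]
  have hak : a ^ k ≠ 0 := pow_ne_zero _ ha0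
  generalize qPoch a P k = A
  generalize qPoch P P k = B
  generalize qPoch (a * y) P k = C
  generalize qPoch (a / y) P k = D
  generalize qPoch (P * y) P k = E
  generalize qPoch (P / y) P k = F
  generalize a ^ k = v at *
  generalize P ^ k = u at *
  clear h2 f1 f2 t2
  field_simp

/-- The value is split so that, for `y = s^2 P^N = q^(2n)`, one part gives the closed form and the
other carries `(1 - y)^3`. -/
theorem sum_symmRatio {s P : K} (hs : s ≠ 0) (hP0 : P ≠ 0)
    (hP : ∀ j : ℕ, P ^ (j + 1) ≠ 1) (hsP : ∀ j : ℕ, s ^ 2 * P ^ j ≠ 1)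
    (hPs : ∀ i j : ℕ, P ^ i ≠ s ^ 2 * P ^ j) (hs2 : 1 + s ^ 2 ≠ 0) (N : ℕ) :
    ∑ k ∈ Finset.range (N + 1), (1 - (s * P ^ k) ^ 2) * (1 - s * P ^ k) ^ 2 / (P ^ k) ^ 2 *
        symmRatio (s ^ 2) P 2 k * symmRatio (s ^ 2) P (s ^ 2 * P ^ N + (s ^ 2 * P ^ N)⁻¹) k =
      (-2 * s * (1 - s) ^ 2 * (1 - s ^ 2 * P ^ N) +
        (1 - s ^ 2 * P ^ N) ^ 3 * s ^ 2 / (s ^ 2 * P ^ N)) * (s ^ 2)⁻¹ ^ N *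
        (qPoch (s ^ 4) P N / ((1 + s ^ 2) * qPoch P P N)) := by
  obtain ⟨a, ha⟩ : ∃ a, a = s ^ 2 := ⟨_, rfl⟩
  have ha0 : a ≠ 0 := ha ▸ pow_ne_zero _ hs
  rw [show s ^ 4 = a * a by rw [ha]; ring]
  simp only [← ha] at hsP hPs hs2 ⊢
  obtain ⟨y, hy⟩ : ∃ y, y = a * P ^ N := ⟨_, rfl⟩
  have hPN : P ^ N ≠ 0 := pow_ne_zero _ hP0
  have hy0 : y ≠ 0 := hy ▸ mul_ne_zero ha0 hPN
  have hy1 : ∀ j : ℕ, P ^ j ≠ y := fun j => hy ▸ hPs j N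
  have S1 : ∑ k ∈ Finset.range (N + 1), sixPhiFiveTerm a (a * y) P N k =
      (1 - y) * qPoch (a * a) P N * a⁻¹ ^ N / qPoch P P N := by
    rw [sum_sixPhiFiveTerm (mul_ne_zero ha0 hy0) hP0 hP (fun j => hsP _)]
    · have h1 := qPoch_inv_div ha0 hP0 a ha0 N
      have h2 : (1 - a) * qPoch (a * P) P N = qPoch a P N * (1 - y) := by
        rw [← qPoch_succ', qPoch_succ, hy]
      have h3 : qPoch a P N ≠ 0 := qPoch_ne_zero fun j _ => hsP j
      rw [show P / (a * y) = P / (a * a * P ^ N) by rw [hy, mul_assoc],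
        show a * P / (a * y) = P / (a * P ^ N) by rw [hy]; field_simp, h2,
        mul_div_mul_comm, h1]
      field_simp
    · intro j
      rw [show a * P ^ (j + 1) / (a * y) = P ^ (j + 1) / y by field_simp, Ne,
        div_eq_one_iff_eq hy0]
      exact hy1 _
  have S2 : ∑ k ∈ Finset.range (N + 1), sixPhiFiveTerm a (a * y * P) P N k =
      (1 - a) * qPoch (a * a * P) P N * a⁻¹ ^ N / qPoch P P N := by
    rw [sum_sixPhiFiveTerm (mul_ne_zero (mul_ne_zero ha0 hy0) hP0) hP0 hP (fun j => hsP _)]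
    · have h1 := qPoch_inv_div ha0 hP0 (a * P) (mul_ne_zero ha0 hP0) N
      have h3 : qPoch (a * P) P N ≠ 0 := qPoch_ne_zero fun j _ => by
        have := hsP (j + 1)
        rwa [pow_succ', ← mul_assoc] at this
      rw [show P / (a * y * P) = P / (a * (a * P) * P ^ N) by rw [hy]; field_simp,
        show a * P / (a * y * P) = P / (a * P * P ^ N) by rw [hy]; field_simp,
        mul_div_mul_comm, h1]
      field_simp
    · intro j
      rw [show a * P ^ (j + 1) / (a * y * P) = P ^ j / y by rw [pow_succ]; field_simp, Ne,
        div_eq_one_iff_eq hy0]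
      exact hy1 _
  rw [← hy]
  simp only [symmRatio_term_eq hs ha hP0 hy hy1]
  rw [Finset.sum_add_distrib, ← Finset.mul_sum, ← Finset.mul_sum, S1, S2]
  have f3 : (1 - a) * qPoch (a * a * P) P N = qPoch (a * a) P N * (1 - a * y) / (1 + a) := by
    rw [eq_div_iff hs2]
    calc _ = (1 - a * a) * qPoch (a * a * P) P N := by ring
      _ = _ := by rw [← qPoch_succ', qPoch_succ, hy, mul_assoc]
  rw [f3]
  have h1 : qPoch P P N ≠ 0 := qPoch_ne_zero fun j _ => by rw [← pow_succ']; exact hP j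
  have h2 : a ^ N ≠ 0 := pow_ne_zero _ ha0
  field_simp
  rw [ha]
  ring

end DeformedSum

/-! ### Congruences in a subring of a field -/

section CongMod

variable {K : Type*} [Field K] {O : Subring K} {w x y z x' y' : K}

/-- Congruence modulo the principal fractional ideal `w O` of a subring `O` of a field. -/
def CongMod (O : Subring K) (w x y : K) : Prop :=
  ∃ c ∈ O, x - y = w * c

theorem CongMod.refl (x : K) : CongMod O w x x := ⟨0, O.zero_mem, by simp⟩

theorem CongMod.of_eq (h : x = y) : CongMod O w x y := h ▸ CongMod.refl x

theorem CongMod.symm : CongMod O w x y → CongMod O w y x := by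
  rintro ⟨c, hc, h⟩
  exact ⟨-c, O.neg_mem hc, by linear_combination -h⟩

theorem CongMod.trans : CongMod O w x y → CongMod O w y z → CongMod O w x z := by
  rintro ⟨c, hc, h⟩ ⟨e, he, h'⟩
  exact ⟨c + e, O.add_mem hc he, by linear_combination h + h'⟩

theorem CongMod.add : CongMod O w x y → CongMod O w x' y' → CongMod O w (x + x') (y + y') := by
  rintro ⟨c, hc, h⟩ ⟨e, he, h'⟩
  exact ⟨c + e, O.add_mem hc he, by linear_combination h + h'⟩

theorem CongMod.sub : CongMod O w x y → CongMod O w x' y' → CongMod O w (x - x') (y - y') := by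
  rintro ⟨c, hc, h⟩ ⟨e, he, h'⟩
  exact ⟨c - e, O.sub_mem hc he, by linear_combination h - h'⟩

theorem CongMod.mul_left (hz : z ∈ O) : CongMod O w x y → CongMod O w (z * x) (z * y) := by
  rintro ⟨c, hc, h⟩
  exact ⟨z * c, O.mul_mem hz hc, by linear_combination z * h⟩

theorem CongMod.mul (hx : x ∈ O) (hy' : y' ∈ O) :
    CongMod O w x y → CongMod O w x' y' → CongMod O w (x * x') (y * y') := by
  rintro ⟨c, hc, h⟩ ⟨e, he, h'⟩
  exact ⟨c * y' + x * e, O.add_mem (O.mul_mem hc hy') (O.mul_mem hx he),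
    by linear_combination y' * h + x * h'⟩

theorem CongMod.pow (hx : x ∈ O) (hy : y ∈ O) (h : CongMod O w x y) (n : ℕ) :
    CongMod O w (x ^ n) (y ^ n) := by
  induction n with
  | zero => simpa using CongMod.refl _
  | succ n ih =>
    rw [pow_succ, pow_succ]
    exact CongMod.mul (O.pow_mem hx n) hy ih h

theorem CongMod.inv (hx0 : x ≠ 0) (hy0 : y ≠ 0) (hx : x⁻¹ ∈ O) (hy : y⁻¹ ∈ O) :
    CongMod O w x y → CongMod O w x⁻¹ y⁻¹ := by
  rintro ⟨c, hc, h⟩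
  refine ⟨-(x⁻¹ * y⁻¹ * c), O.neg_mem (O.mul_mem (O.mul_mem hx hy) hc), ?_⟩
  have : x⁻¹ - y⁻¹ = -(x - y) * (x⁻¹ * y⁻¹) := by
    field_simp
    ring
  rw [this, h]
  ring

theorem CongMod.sum {ι : Type*} {s : Finset ι} {f g : ι → K}
    (h : ∀ i ∈ s, CongMod O w (f i) (g i)) : CongMod O w (∑ i ∈ s, f i) (∑ i ∈ s, g i) := by
  classical
  induction s using Finset.induction_on with
  | empty => exact CongMod.refl _
  | insert a s ha ih =>
    rw [Finset.sum_insert ha, Finset.sum_insert ha]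
    exact (h a (Finset.mem_insert_self _ _)).add
      (ih fun i hi => h i (Finset.mem_insert_of_mem hi))

theorem CongMod.prod {ι : Type*} {s : Finset ι} {f g : ι → K}
    (hf : ∀ i ∈ s, f i ∈ O) (hg : ∀ i ∈ s, g i ∈ O)
    (h : ∀ i ∈ s, CongMod O w (f i) (g i)) : CongMod O w (∏ i ∈ s, f i) (∏ i ∈ s, g i) := by
  classical
  induction s using Finset.induction_on with
  | empty => exact CongMod.refl _
  | insert a s ha ih =>
    rw [Finset.prod_insert ha, Finset.prod_insert ha]
    exact CongMod.mul (hf a (Finset.mem_insert_self _ _))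
      (O.prod_mem fun i hi => hg i (Finset.mem_insert_of_mem hi))
      (h a (Finset.mem_insert_self _ _))
      (ih (fun i hi => hf i (Finset.mem_insert_of_mem hi))
        (fun i hi => hg i (Finset.mem_insert_of_mem hi))
        fun i hi => h i (Finset.mem_insert_of_mem hi))

theorem CongMod.sum_zero {ι : Type*} {s : Finset ι} {f : ι → K}
    (h : ∀ i ∈ s, CongMod O w (f i) 0) : CongMod O w (∑ i ∈ s, f i) 0 := by
  simpa using CongMod.sum h

theorem CongMod.mul_left_zero (hz : z ∈ O) (h : CongMod O w x 0) : CongMod O w (z * x) 0 := by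
  simpa using h.mul_left hz

theorem CongMod.mul_zero_mul {w' : K} (h : CongMod O w x 0) (h' : CongMod O w' y 0) :
    CongMod O (w * w') (x * y) 0 := by
  obtain ⟨c, hc, h⟩ := h
  obtain ⟨e, he, h'⟩ := h'
  refine ⟨c * e, O.mul_mem hc he, ?_⟩
  rw [sub_zero] at *
  rw [h, h']
  ring

theorem CongMod.sub_zero_iff : CongMod O w (x - y) 0 ↔ CongMod O w x y := by
  simp [CongMod]

/-- A sum of terms that are antisymmetric modulo `w O` under reversal vanishes modulo `w O`. -/
theorem CongMod.sum_range_antisymm (h2 : (2 : K)⁻¹ ∈ O) (h20 : (2 : K) ≠ 0) {N : ℕ} {f : ℕ → K}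
    (h : ∀ k ≤ N, CongMod O w (f k + f (N - k)) 0) :
    CongMod O w (∑ k ∈ Finset.range (N + 1), f k) 0 := by
  have e : ∑ k ∈ Finset.range (N + 1), f k =
      2⁻¹ * ∑ k ∈ Finset.range (N + 1), (f k + f (N - k)) := by
    have := Finset.sum_range_reflect f (N + 1)
    simp only [Nat.add_sub_cancel] at this
    rw [Finset.sum_add_distrib, this]
    field_simp
    ring
  rw [e]
  exact CongMod.mul_left_zero h2 (CongMod.sum_zero fun k hk =>
    h k (Nat.lt_succ_iff.mp (Finset.mem_range.mp hk)))

/-- This is the symmetry of generalized binomial coefficients: both sides are `u_1 ⋯ u_N / (u_1 ⋯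
u_k · u_1 ⋯ u_{N-k})`. -/
theorem prod_div_reflect {u : ℕ → K} {N : ℕ} (h0 : ∀ i, 1 ≤ i → i ≤ N → u i ≠ 0)
    {k : ℕ} (hk : k ≤ N) :
    ∏ j ∈ Finset.range k, u (N - j) / u (j + 1) =
      ∏ j ∈ Finset.range (N - k), u (N - j) / u (j + 1) := by
  have key : ∀ k ≤ N, (∏ j ∈ Finset.range (N - k), u (j + 1)) * ∏ j ∈ Finset.range k, u (N - j) =
      ∏ j ∈ Finset.range N, u (j + 1) := by
    intro k
    induction k with
    | zero => intro _; simp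
    | succ k ih =>
      intro hk
      rw [← ih (by omega), Finset.prod_range_succ, show N - k = N - (k + 1) + 1 by omega,
        Finset.prod_range_succ]
      ring
  have h1 := key k hk
  have h2 := key (N - k) (by omega)
  rw [show N - (N - k) = k by omega] at h2
  have n1 : ∏ j ∈ Finset.range k, u (j + 1) ≠ 0 := Finset.prod_ne_zero_iff.mpr fun j hj =>
    h0 _ (by omega) (by have := Finset.mem_range.mp hj; omega)
  have n2 : ∏ j ∈ Finset.range (N - k), u (j + 1) ≠ 0 := Finset.prod_ne_zero_iff.mpr fun j hj =>
    h0 _ (by omega) (by have := Finset.mem_range.mp hj; omega)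
  rw [Finset.prod_div_distrib, Finset.prod_div_distrib, div_eq_div_iff n1 n2]
  linear_combination h1 - h2

/-- If `f j ≡ u (N - j)`, then the products `∏_{j<k} f j / u (j + 1)` are symmetric
under `k ↦ N - k`. -/
theorem CongMod.prod_div_symm {u f : ℕ → K} {N : ℕ} (h0 : ∀ i, 1 ≤ i → i ≤ N → u i ≠ 0)
    (hu : ∀ i, 1 ≤ i → i ≤ N → u i ∈ O) (hu' : ∀ i, 1 ≤ i → i ≤ N → (u i)⁻¹ ∈ O)
    (hf : ∀ j < N, f j ∈ O) (h : ∀ j < N, CongMod O w (f j) (u (N - j))) {k : ℕ} (hk : k ≤ N) :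
    CongMod O w (∏ j ∈ Finset.range k, f j / u (j + 1))
      (∏ j ∈ Finset.range (N - k), f j / u (j + 1)) := by
  have key : ∀ k ≤ N, CongMod O w (∏ j ∈ Finset.range k, f j / u (j + 1))
      (∏ j ∈ Finset.range k, u (N - j) / u (j + 1)) := by
    intro k hk
    have hj : ∀ j ∈ Finset.range k, j < N := fun j hj => (Finset.mem_range.mp hj).trans_le hk
    refine CongMod.prod (fun j hj' => ?_) (fun j hj' => ?_) fun j hj' => ?_
    · exact div_eq_mul_inv (f j) _ ▸ O.mul_mem (hf j (hj j hj'))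
        (hu' _ (by omega) (by have := hj j hj'; omega))
    · exact div_eq_mul_inv (u (N - j)) _ ▸ O.mul_mem
        (hu _ (by have := hj j hj'; omega) (by omega))
        (hu' _ (by omega) (by have := hj j hj'; omega))
    · rw [div_eq_mul_inv, div_eq_mul_inv, mul_comm (f j), mul_comm (u (N - j))]
      exact (h j (hj j hj')).mul_left (hu' _ (by omega) (by have := hj j hj'; omega))
  exact ((key k hk).trans (CongMod.of_eq (prod_div_reflect h0 hk))).trans
    (key (N - k) (by omega)).symm

end CongMod

/-! ### Arithmetic in the localization at `Φ_m(q^2)` -/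

section CyclotomicLocal

variable {K : Type*} [Field K] {O : Subring K} {q : K} {m : ℕ}

/-- The properties of the localization `O` of `ℚ[q]` at `Φ_m(q ^ 2)` that are used below.
In it, `1 - q ^ (2 m)` generates the ideal of `Φ_m(q ^ 2)`. -/
structure IsCyclotomicLocal (O : Subring K) (q : K) (m : ℕ) : Prop where
  one_lt : 1 < m
  ne_zero : q ≠ 0
  mem : q ∈ O
  inv_mem : q⁻¹ ∈ O
  zpow_ne_one : ∀ L : ℤ, L ≠ 0 → q ^ L ≠ 1
  two_ne_zero : (2 : K) ≠ 0
  two_inv_mem : (2 : K)⁻¹ ∈ O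
  one_sub_inv_mem : ∀ L : ℤ, ¬ (m : ℤ) ∣ L → (1 - q ^ (2 * L))⁻¹ ∈ O
  div_one_sub_mem : ∀ L : ℤ, (m : ℤ) ∣ L → L ≠ 0 →
    (1 - q ^ (2 * (m : ℤ))) / (1 - q ^ (2 * L)) ∈ O

/-- The symmetric square `q ^ (2 L) + q ^ (-2 L) - 2 = (q ^ L - q ^ (-L)) ^ 2`. -/
def symmSq (q : K) (L : ℤ) : K := q ^ (2 * L) + (q ^ (2 * L))⁻¹ - 2

namespace IsCyclotomicLocal

variable (h : IsCyclotomicLocal O q m)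
include h

theorem zpow_mem (L : ℤ) : q ^ L ∈ O := by
  obtain ⟨n, rfl | rfl⟩ := L.eq_nat_or_neg
  · rw [zpow_natCast]
    exact O.pow_mem h.mem n
  · rw [zpow_neg, ← inv_zpow, zpow_natCast]
    exact O.pow_mem h.inv_mem n

theorem zpow_inv_mem (L : ℤ) : (q ^ L)⁻¹ ∈ O := by
  rw [← zpow_neg]
  exact h.zpow_mem _

theorem zpow_ne_zero' (L : ℤ) : q ^ L ≠ 0 := zpow_ne_zero _ h.ne_zero

theorem one_sub_mem (L : ℤ) : 1 - q ^ L ∈ O := O.sub_mem O.one_mem (h.zpow_mem L)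

theorem one_sub_ne_zero {L : ℤ} (hL : L ≠ 0) : 1 - q ^ L ≠ 0 :=
  sub_ne_zero.mpr (h.zpow_ne_one L hL).symm

theorem one_sub_cong_zero {L : ℤ} (hL : (m : ℤ) ∣ L) :
    CongMod O (1 - q ^ (2 * (m : ℤ))) (1 - q ^ (2 * L)) 0 := by
  have nat : ∀ n : ℕ, CongMod O (1 - q ^ (2 * (m : ℤ))) (1 - q ^ (2 * ((m : ℤ) * n))) 0 := by
    intro n
    refine ⟨∑ i ∈ Finset.range n, (q ^ (2 * (m : ℤ))) ^ i,
      O.sum_mem fun i _ => O.pow_mem (h.zpow_mem _) i, ?_⟩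
    rw [mul_comm (1 - _), geom_sum_mul_neg, sub_zero, ← mul_assoc, zpow_mul, zpow_natCast]
  obtain ⟨c, rfl⟩ := hL
  obtain ⟨n, rfl | rfl⟩ := c.eq_nat_or_neg
  · exact nat n
  · have := (nat n).mul_left_zero (h.zpow_mem (2 * (m * -(n : ℤ))) |> O.neg_mem)
    have e : -q ^ (2 * (m * -(n : ℤ))) * (1 - q ^ (2 * ((m : ℤ) * n))) =
        1 - q ^ (2 * (m * -(n : ℤ))) := by
      have : q ^ (2 * (m * -(n : ℤ))) * q ^ (2 * ((m : ℤ) * n)) = 1 := by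
        rw [← zpow_add₀ h.ne_zero, show 2 * ((m : ℤ) * -(n : ℤ)) + 2 * (m * n) = 0 by ring, zpow_zero]
      linear_combination this
    rwa [e] at this

theorem zpow_cong {L L' : ℤ} (hL : (2 * m : ℤ) ∣ L - L') :
    CongMod O (1 - q ^ (2 * (m : ℤ))) (q ^ L) (q ^ L') := by
  obtain ⟨c, hc⟩ := hL
  have h1 := (h.one_sub_cong_zero (Dvd.intro c rfl)).mul_left_zero (O.neg_mem (h.zpow_mem L'))
  rw [← CongMod.sub_zero_iff]
  have e : -q ^ L' * (1 - q ^ (2 * ((m : ℤ) * c))) = q ^ L - q ^ L' := by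
    have : q ^ L' * q ^ (2 * ((m : ℤ) * c)) = q ^ L := by
      rw [← zpow_add₀ h.ne_zero]
      congr 1
      linear_combination -hc
    linear_combination this
  rwa [e] at h1

theorem div_mem {L L' : ℤ} (hL : (m : ℤ) ∣ L) (hL' : (m : ℤ) ∣ L') (h0 : L' ≠ 0) :
    (1 - q ^ (2 * L)) / (1 - q ^ (2 * L')) ∈ O := by
  obtain ⟨c, hc, e⟩ := h.one_sub_cong_zero hL
  rw [sub_zero] at e
  rw [e, mul_comm, mul_div_assoc]
  exact O.mul_mem hc (h.div_one_sub_mem L' hL' h0)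

theorem symmSq_mem (L : ℤ) : symmSq q L ∈ O :=
  O.sub_mem (O.add_mem (h.zpow_mem _) (h.zpow_inv_mem _)) (by exact_mod_cast natCast_mem O 2)

omit h in
theorem symmSq_neg (q : K) (L : ℤ) : symmSq q (-L) = symmSq q L := by
  rw [symmSq, symmSq, mul_neg, zpow_neg, inv_inv, add_comm (q ^ (2 * L))⁻¹]

theorem symmSq_eq (L : ℤ) : symmSq q L = (1 - q ^ (2 * L)) ^ 2 * (q ^ (2 * L))⁻¹ := by
  have := h.zpow_ne_zero' (2 * L)
  rw [symmSq]
  field_simp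
  ring

theorem symmSq_sub_symmSq (L n : ℤ) : symmSq q L - symmSq q n =
    (1 - q ^ (2 * (L + n))) * (1 - q ^ (2 * (L - n))) * (q ^ (2 * L))⁻¹ := by
  have h1 := h.zpow_ne_zero' (2 * L)
  have h2 := h.zpow_ne_zero' (2 * n)
  rw [symmSq, symmSq, mul_add 2, mul_sub 2, zpow_add₀ h.ne_zero, zpow_sub₀ h.ne_zero,
    ← div_eq_mul_inv, ← add_inv_sub_add_inv h1 h2]
  ring

theorem symmSq_ne_zero {L : ℤ} (hL : L ≠ 0) : symmSq q L ≠ 0 := by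
  rw [h.symmSq_eq]
  exact mul_ne_zero (pow_ne_zero _ (h.one_sub_ne_zero (by omega))) (inv_ne_zero (h.zpow_ne_zero' _))

theorem symmSq_inv_mem {L : ℤ} (hL : ¬ (m : ℤ) ∣ L) : (symmSq q L)⁻¹ ∈ O := by
  rw [h.symmSq_eq, mul_inv, inv_inv, ← inv_pow]
  exact O.mul_mem (O.pow_mem (h.one_sub_inv_mem L hL) 2) (h.zpow_mem _)

theorem symmSq_cong {L L' : ℤ} (hL : (m : ℤ) ∣ L - L') :
    CongMod O (1 - q ^ (2 * (m : ℤ))) (symmSq q L) (symmSq q L') := by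
  obtain ⟨c, hc⟩ := hL
  have h1 : CongMod O (1 - q ^ (2 * (m : ℤ))) (q ^ (2 * L)) (q ^ (2 * L')) :=
    h.zpow_cong ⟨c, by linear_combination 2 * hc⟩
  exact (h1.add (h1.inv (h.zpow_ne_zero' _) (h.zpow_ne_zero' _) (h.zpow_inv_mem _)
    (h.zpow_inv_mem _))).sub (CongMod.refl _)

theorem symmSq_cong_zero {L : ℤ} (hL : (m : ℤ) ∣ L) :
    CongMod O ((1 - q ^ (2 * (m : ℤ))) ^ 2) (symmSq q L) 0 := by
  have h1 := h.one_sub_cong_zero hL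
  have h2 := (h1.mul_zero_mul h1).mul_left_zero (h.zpow_inv_mem (2 * L))
  rw [← pow_two, ← pow_two, mul_comm _⁻¹, ← h.symmSq_eq] at h2
  exact h2

end IsCyclotomicLocal

end CyclotomicLocal

/-! ### The summand in symmetric form -/

section SymmetricForm

variable {K : Type*} [Field K]

/-- `symmRatio` for `a = q ^ (2 t)` and `P = q ^ (2 d)`. -/
def symmSqRatio (q : K) (d : ℕ) (t : ℤ) (δ : K) (k : ℕ) : K :=
  ∏ j ∈ Finset.range k,
    (symmSq q (t + d * (j : ℤ)) - δ) / (symmSq q (d * ((j + 1 : ℕ) : ℤ)) - δ)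

/-- The well-poised part of the summand, which is antisymmetric under `L ↦ -L`. -/
def poisedFactor (q : K) (L : ℤ) : K := (1 - q ^ (2 * L)) * (1 - q ^ L) ^ 2 * (q ^ (2 * L))⁻¹

theorem poisedFactor_neg {q : K} (hq : q ≠ 0) (L : ℤ) :
    poisedFactor q (-L) = -poisedFactor q L := by
  have h1 : q ^ L ≠ 0 := zpow_ne_zero _ hq
  rw [poisedFactor, poisedFactor, mul_comm 2, zpow_mul, mul_comm 2, zpow_mul, zpow_neg]
  norm_cast
  field_simp
  ring

theorem symmRatio_eq_symmSqRatio {q : K} (hq : q ≠ 0) (d : ℕ) (t : ℤ) (δ : K) (k : ℕ) :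
    symmRatio (q ^ (2 * t)) (q ^ (2 * d)) (2 + δ) k = symmSqRatio q d t δ k := by
  refine Finset.prod_congr rfl fun j _ => ?_
  have e1 : q ^ (2 * t) * (q ^ (2 * d)) ^ j = q ^ (2 * (t + d * (j : ℤ))) := by
    rw [← pow_mul, ← zpow_natCast, ← zpow_add₀ hq]
    congr 1
    push_cast
    ring
  have e2 : (q ^ (2 * d)) ^ (j + 1) = q ^ (2 * (d * ((j + 1 : ℕ) : ℤ))) := by
    rw [← pow_mul, ← zpow_natCast]
    congr 1
    push_cast
    ring
  rw [e1, e2, symmSq, symmSq, sub_sub, sub_sub]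

theorem summand_eq {q : K} (hq : q ≠ 0) (d : ℕ) (t : ℤ) (k : ℕ) :
    summand q d t k = q ^ (2 * t) / ((1 - q ^ 2) * (1 - q) ^ 2) *
      (poisedFactor q (2 * d * k + t) * symmSqRatio q d t 0 k ^ 2) := by
  have h1 := symmRatio_add_inv (a := q ^ (2 * t)) (P := q ^ (2 * d)) (zpow_ne_zero _ hq)
    (pow_ne_zero _ hq) one_ne_zero k
  have h2 := symmRatio_eq_symmSqRatio hq d t 0 k
  rw [inv_one, one_add_one_eq_two, mul_one, mul_one, div_one, div_one] at h1
  rw [add_zero] at h2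
  rw [← h2, h1, summand, qInt, qInt, poisedFactor]
  have e1 : ((q ^ 2) ^ (2 * d * k + t : ℤ) : K) = q ^ (2 * (2 * d * k + t : ℤ)) := by
    rw [← zpow_natCast, ← zpow_mul]
    rfl
  have e2 : (q ^ (-4 * t * k : ℤ) : K) = q ^ (2 * t) * (q ^ (2 * (2 * d * k + t : ℤ)))⁻¹ *
      ((q ^ (2 * d) / q ^ (2 * t)) ^ k) ^ 2 := by
    rw [← zpow_neg, ← zpow_natCast, ← zpow_natCast, ← zpow_natCast, ← zpow_sub₀ hq, ← zpow_mul,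
      ← zpow_mul, ← zpow_add₀ hq, ← zpow_add₀ hq]
    congr 1
    push_cast
    ring
  rw [e1, e2]
  generalize (q ^ (2 * d) / q ^ (2 * t)) ^ k = Z
  generalize (q ^ (2 * (2 * d * k + t : ℤ)) : K) = X
  generalize 1 - q = D
  simp only [div_eq_mul_inv, mul_inv, mul_pow]
  ring

end SymmetricForm

/-! ### Integrality of the products -/

namespace IsCyclotomicLocal

variable {K : Type*} [Field K] {O : Subring K} {q : K} {m : ℕ} (h : IsCyclotomicLocal O q m)
include h

theorem poisedFactor_mem (L : ℤ) : poisedFactor q L ∈ O :=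
  O.mul_mem (O.mul_mem (h.one_sub_mem _) (O.pow_mem (h.one_sub_mem _) 2)) (h.zpow_inv_mem _)

/-- The period is `2m` rather than `m` because of the factor `(1 - q^L)^2`, whose exponent is not
doubled. -/
theorem poisedFactor_cong {L L' : ℤ} (hL : (2 * m : ℤ) ∣ L - L') :
    CongMod O (1 - q ^ (2 * (m : ℤ))) (poisedFactor q L) (poisedFactor q L') := by
  have h1 := h.zpow_cong hL
  have h2 : CongMod O (1 - q ^ (2 * (m : ℤ))) (q ^ (2 * L)) (q ^ (2 * L')) :=
    h.zpow_cong (by rw [← mul_sub]; exact hL.mul_left 2)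
  refine CongMod.mul (O.mul_mem (h.one_sub_mem _) (O.pow_mem (h.one_sub_mem _) 2))
    (h.zpow_inv_mem _) (CongMod.mul (h.one_sub_mem _) (O.pow_mem (h.one_sub_mem _) 2)
    ((CongMod.refl 1).sub h2) (((CongMod.refl 1).sub h1).pow (h.one_sub_mem _)
    (h.one_sub_mem _) 2)) (h2.inv (h.zpow_ne_zero' _) (h.zpow_ne_zero' _) (h.zpow_inv_mem _)
    (h.zpow_inv_mem _))

omit h in
theorem exists_dvd_add_mul {d : ℕ} (hm : 0 < m) (hmd : IsCoprime (m : ℤ) d) (B : ℤ) :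
    ∃ j < m, (m : ℤ) ∣ B + d * (j : ℤ) := by
  obtain ⟨a, b, hab⟩ := hmd
  have hm' : (0 : ℤ) < m := by exact_mod_cast hm
  have h0 := Int.emod_nonneg (-B * b) hm'.ne'
  have h1 := Int.emod_lt_of_pos (-B * b) hm'
  have h2 := Int.emod_add_mul_ediv (-B * b) m
  refine ⟨((-B * b) % m).toNat, by omega, ?_⟩
  rw [Int.toNat_of_nonneg h0]
  refine ⟨B * a - d * (-B * b / m), ?_⟩
  linear_combination (-B) * hab + (d : ℤ) * h2

omit h in
theorem dvd_sub_of_dvd {d : ℕ} (hmd : IsCoprime (m : ℤ) d) {B i j : ℤ}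
    (hi : (m : ℤ) ∣ B + d * i) (hj : (m : ℤ) ∣ B + d * j) : (m : ℤ) ∣ i - j := by
  refine hmd.dvd_of_dvd_mul_left ?_
  have := dvd_sub hi hj
  rwa [show B + d * i - (B + d * j) = d * (i - j) by ring] at this

omit h in
theorem eq_of_dvd_sub {i j : ℕ} (hi : i < m) (hj : j < m) (hij : (m : ℤ) ∣ (i : ℤ) - j) :
    i = j := by
  have := Int.eq_zero_of_abs_lt_dvd hij (by rw [abs_lt]; omega)
  omega

/-- As `d` is invertible mod `m`, exactly one numerator and one denominator in the block are
non-units. Their quotient is integral, even when they sit at different indices. -/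
theorem prod_block_mem {d : ℕ} (hmd : IsCoprime (m : ℤ) d) (B C : ℤ)
    (hC : ∀ j : ℕ, C + d * (j : ℤ) ≠ 0) :
    ∏ j ∈ Finset.range m, (1 - q ^ (2 * (B + d * (j : ℤ)))) / (1 - q ^ (2 * (C + d * (j : ℤ)))) ∈
      O := by
  have hm : 0 < m := by have := h.one_lt; omega
  obtain ⟨i, hi, hi'⟩ := exists_dvd_add_mul hm hmd B
  obtain ⟨l, hl, hl'⟩ := exists_dvd_add_mul hm hmd C
  rw [Finset.prod_div_distrib, ← Finset.mul_prod_erase _ _ (Finset.mem_range.mpr hi),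
    ← Finset.mul_prod_erase _ (fun j : ℕ => 1 - q ^ (2 * (C + d * (j : ℤ))))
      (Finset.mem_range.mpr hl), mul_div_mul_comm, div_eq_mul_inv (∏ _ ∈ _, _),
    ← Finset.prod_inv_distrib]
  refine O.mul_mem (h.div_mem hi' hl' (hC l)) (O.mul_mem (O.prod_mem fun j _ => h.one_sub_mem _)
    (O.prod_mem fun j hj => h.one_sub_inv_mem _ fun hj' => ?_))
  rw [Finset.mem_erase, Finset.mem_range] at hj
  exact hj.1 (eq_of_dvd_sub hj.2 hl (dvd_sub_of_dvd hmd hj' hl'))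

/-- Ratios of `q`-shifted factorials `∏_{j<M} (1 - q ^ (2 (B + d j))) / (1 - q ^ (2 d (j + 1)))`
are integral. -/
theorem prod_div_mem {d : ℕ} (hd : 0 < d) (hmd : IsCoprime (m : ℤ) d) (B : ℤ) (M : ℕ) :
    ∏ j ∈ Finset.range M,
      (1 - q ^ (2 * (B + d * (j : ℤ)))) / (1 - q ^ (2 * (d * ((j + 1 : ℕ) : ℤ)))) ∈ O := by
  have hm : 0 < m := by have := h.one_lt; omega
  -- The incomplete block comes first: there `j + 1 < m`, so all its denominators are units.
  have key : ∀ R s : ℕ, s < m → ∏ j ∈ Finset.range (s + R * m),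
      (1 - q ^ (2 * (B + d * (j : ℤ)))) / (1 - q ^ (2 * (d * ((j + 1 : ℕ) : ℤ)))) ∈ O := by
    intro R s hs
    induction R with
    | zero =>
      rw [zero_mul, add_zero]
      refine O.prod_mem fun j hj => ?_
      rw [div_eq_mul_inv]
      refine O.mul_mem (h.one_sub_mem _) (h.one_sub_inv_mem _ fun hj' => ?_)
      have h1 := Int.le_of_dvd (by positivity) (hmd.dvd_of_dvd_mul_left hj')
      have := Finset.mem_range.mp hj
      push_cast at h1
      omega
    | succ R ih =>
      rw [Nat.succ_mul, ← add_assoc, Finset.prod_range_add]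
      refine O.mul_mem ih ?_
      have := h.prod_block_mem hmd (B + d * ((s + R * m : ℕ) : ℤ)) (d * ((s + R * m + 1 : ℕ) : ℤ))
        (fun j => by positivity)
      convert this using 5 <;> push_cast <;> ring
  have := key (M / m) (M % m) (Nat.mod_lt _ hm)
  rwa [mul_comm (M / m), Nat.mod_add_div] at this

theorem symmSqRatio_zero_mem {d : ℕ} (hd : 0 < d) (hmd : IsCoprime (m : ℤ) d) (t : ℤ) (k : ℕ) :
    symmSqRatio q d t 0 k ∈ O := by
  have e : symmSqRatio q d t 0 k = (∏ j ∈ Finset.range k,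
      (1 - q ^ (2 * (t + d * (j : ℤ)))) / (1 - q ^ (2 * (d * ((j + 1 : ℕ) : ℤ))))) ^ 2 *
      ∏ j ∈ Finset.range k, ((q ^ (2 * (t + d * (j : ℤ))))⁻¹ *
        q ^ (2 * (d * ((j + 1 : ℕ) : ℤ)))) := by
    rw [← Finset.prod_pow, ← Finset.prod_mul_distrib]
    refine Finset.prod_congr rfl fun j _ => ?_
    rw [sub_zero, sub_zero, h.symmSq_eq, h.symmSq_eq]
    simp only [div_eq_mul_inv, mul_inv, inv_inv, mul_pow, ← inv_pow]
    ring
  rw [e]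
  exact O.mul_mem (O.pow_mem (h.prod_div_mem hd hmd t k) 2)
    (O.prod_mem fun j _ => O.mul_mem (h.zpow_inv_mem _) (h.zpow_mem _))

end IsCyclotomicLocal

/-! ### Vanishing of the sums modulo `Φ_m(q^2)` -/

namespace IsCyclotomicLocal

variable {K : Type*} [Field K] {O : Subring K} {q : K} {m : ℕ} (h : IsCyclotomicLocal O q m)
  {d : ℕ} {t : ℤ}

/-- The `k`-th summand up to a factor that does not depend on `k`. -/
def coreTerm (q : K) (d : ℕ) (t : ℤ) (k : ℕ) : K :=
  poisedFactor q (2 * d * k + t) * symmSqRatio q d t 0 k ^ 2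

theorem not_dvd_mul {i : ℕ} (hmd : IsCoprime (m : ℤ) d) (hi0 : 0 < i) (hi : i < m) :
    ¬ (m : ℤ) ∣ d * (i : ℤ) := fun hi' => by
  have := Int.le_of_dvd (by positivity) (hmd.dvd_of_dvd_mul_left hi')
  omega

include h

theorem coreTerm_mem (hd : 0 < d) (hmd : IsCoprime (m : ℤ) d) (t : ℤ) (k : ℕ) :
    coreTerm q d t k ∈ O :=
  O.mul_mem (h.poisedFactor_mem _) (O.pow_mem (h.symmSqRatio_zero_mem hd hmd t k) 2)

/-- Modulo `m`, `t + dj ≡ -d(s - j)`, so the ratios are symmetric. The arguments `2dk + t` and `2d(s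
- k) + t` add up to `2(t + ds)`, a multiple of `2m`, so the odd factor changes sign. -/
theorem coreTerm_add_reflect (hd : 0 < d) (hmd : IsCoprime (m : ℤ) d) {s : ℕ} (hsm : s < m)
    (hs : (m : ℤ) ∣ t + d * (s : ℤ)) {k : ℕ} (hk : k ≤ s) :
    CongMod O (1 - q ^ (2 * (m : ℤ))) (coreTerm q d t k + coreTerm q d t (s - k)) 0 := by
  have h1 : CongMod O (1 - q ^ (2 * (m : ℤ))) (symmSqRatio q d t 0 k)
      (symmSqRatio q d t 0 (s - k)) := by
    refine CongMod.prod_div_symm (u := fun i : ℕ => symmSq q (d * (i : ℤ)) - 0)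
      (f := fun j : ℕ => symmSq q (t + d * (j : ℤ)) - 0) ?_ ?_ ?_ ?_ ?_ hk
    · intro i hi _
      rw [sub_zero]
      exact h.symmSq_ne_zero (by positivity)
    · intro i _ _
      exact O.sub_mem (h.symmSq_mem _) O.zero_mem
    · intro i hi hi'
      rw [sub_zero]
      exact h.symmSq_inv_mem (not_dvd_mul hmd hi (by omega))
    · intro i _
      exact O.sub_mem (h.symmSq_mem _) O.zero_mem
    · intro j hj
      rw [sub_zero, sub_zero, ← symmSq_neg]
      refine h.symmSq_cong ?_
      rw [Nat.cast_sub hj.le, ← dvd_neg]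
      convert hs using 2
      · rfl
      ring
  have h2 : CongMod O (1 - q ^ (2 * (m : ℤ))) (poisedFactor q (2 * d * (s - k : ℕ) + t))
      (-poisedFactor q (2 * d * k + t)) := by
    rw [← poisedFactor_neg h.ne_zero]
    refine h.poisedFactor_cong ?_
    rw [Nat.cast_sub hk]
    convert mul_dvd_mul_left 2 hs using 2
    · rfl
    ring
  have h3 := CongMod.mul (O.neg_mem (h.poisedFactor_mem (2 * d * k + t)))
    (O.pow_mem (h.symmSqRatio_zero_mem hd hmd t (s - k)) 2) h2.symm
    (h1.pow (h.symmSqRatio_zero_mem hd hmd t k) (h.symmSqRatio_zero_mem hd hmd t (s - k)) 2)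
  rw [← CongMod.sub_zero_iff] at h3
  convert h3.mul_left_zero (O.neg_mem O.one_mem) using 1
  rw [coreTerm, coreTerm]
  ring

theorem sum_coreTerm_reflect (hd : 0 < d) (hmd : IsCoprime (m : ℤ) d) {s : ℕ} (hsm : s < m)
    (hs : (m : ℤ) ∣ t + d * (s : ℤ)) :
    CongMod O (1 - q ^ (2 * (m : ℤ))) (∑ k ∈ Finset.range (s + 1), coreTerm q d t k) 0 :=
  CongMod.sum_range_antisymm h.two_inv_mem h.two_ne_zero fun _ hk =>
    h.coreTerm_add_reflect hd hmd hsm hs hk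

/-- The factor `σ(t + ds)` is divisible by the square of the generator, it occurs in a ratio that is
squared, and all denominators are still units for `k < m`. -/
theorem coreTerm_cong_zero_of_lt (hmd : IsCoprime (m : ℤ) d) {s : ℕ}
    (hs : (m : ℤ) ∣ t + d * (s : ℤ)) {k : ℕ} (hk : s < k) (hkm : k < m) :
    CongMod O ((1 - q ^ (2 * (m : ℤ))) ^ 4) (coreTerm q d t k) 0 := by
  have h1 : CongMod O ((1 - q ^ (2 * (m : ℤ))) ^ 2) (symmSqRatio q d t 0 k) 0 := by
    rw [symmSqRatio, Finset.prod_div_distrib, ← Finset.mul_prod_erase _ _ (Finset.mem_range.mpr hk),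
      div_eq_mul_inv, mul_assoc, sub_zero, mul_comm (symmSq q (t + d * (s : ℤ))), ← Finset.prod_inv_distrib]
    refine CongMod.mul_left_zero (O.mul_mem (O.prod_mem fun j _ => ?_) (O.prod_mem fun j hj => ?_))
      (h.symmSq_cong_zero hs)
    · exact O.sub_mem (h.symmSq_mem _) O.zero_mem
    · rw [sub_zero]
      have := Finset.mem_range.mp hj
      exact h.symmSq_inv_mem (not_dvd_mul hmd (Nat.succ_pos j) (by omega))
  have h2 := (h1.mul_zero_mul h1).mul_left_zero (h.poisedFactor_mem (2 * d * k + t))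
  rw [← pow_two, ← pow_two, ← pow_mul] at h2
  exact h2

theorem coreTerm_block (hd : 0 < d) (hmd : IsCoprime (m : ℤ) d) (t : ℤ) (R : ℕ) {s : ℕ}
    (hsm : s < m) :
    CongMod O (1 - q ^ (2 * (m : ℤ))) (coreTerm q d t (R * m + s))
      (symmSqRatio q d t 0 (R * m) ^ 2 * coreTerm q d t s) := by
  have h1 : CongMod O (1 - q ^ (2 * (m : ℤ)))
      (∏ j ∈ Finset.range s, (symmSq q (t + d * ((R * m + j : ℕ) : ℤ)) - 0) /
        (symmSq q (d * ((R * m + j + 1 : ℕ) : ℤ)) - 0)) (symmSqRatio q d t 0 s) ∧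
      ∏ j ∈ Finset.range s, (symmSq q (t + d * ((R * m + j : ℕ) : ℤ)) - 0) /
        (symmSq q (d * ((R * m + j + 1 : ℕ) : ℤ)) - 0) ∈ O := by
    have hden : ∀ j ∈ Finset.range s, ¬ (m : ℤ) ∣ d * ((R * m + j + 1 : ℕ) : ℤ) := by
      intro j hj hj'
      have := Finset.mem_range.mp hj
      refine not_dvd_mul hmd (Nat.succ_pos j) (by omega) ?_
      rw [← dvd_add_right (Dvd.intro (d * R : ℤ) rfl)]
      convert hj' using 2
      · rfl
      push_cast
      ring
    have hden' : ∀ j ∈ Finset.range s, ¬ (m : ℤ) ∣ d * ((j + 1 : ℕ) : ℤ) := by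
      intro j hj
      have := Finset.mem_range.mp hj
      exact not_dvd_mul hmd (Nat.succ_pos j) (by omega)
    have hmem : ∀ j ∈ Finset.range s, (symmSq q (t + d * ((R * m + j : ℕ) : ℤ)) - 0) /
        (symmSq q (d * ((R * m + j + 1 : ℕ) : ℤ)) - 0) ∈ O := by
      intro j hj
      rw [sub_zero, sub_zero, div_eq_mul_inv]
      exact O.mul_mem (h.symmSq_mem _) (h.symmSq_inv_mem (hden j hj))
    refine ⟨CongMod.prod hmem ?_ ?_, O.prod_mem hmem⟩
    · intro j hj
      rw [sub_zero, sub_zero, div_eq_mul_inv]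
      exact O.mul_mem (h.symmSq_mem _) (h.symmSq_inv_mem (hden' j hj))
    · intro j hj
      rw [sub_zero, sub_zero, sub_zero, sub_zero, div_eq_mul_inv, div_eq_mul_inv]
      refine CongMod.mul (h.symmSq_mem _) (h.symmSq_inv_mem (hden' j hj)) (h.symmSq_cong ?_)
        ((h.symmSq_cong ?_).inv (h.symmSq_ne_zero (by positivity))
        (h.symmSq_ne_zero (by positivity)) (h.symmSq_inv_mem (hden j hj))
        (h.symmSq_inv_mem (hden' j hj)))
      · exact ⟨d * R, by push_cast; ring⟩
      · exact ⟨d * R, by push_cast; ring⟩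
  have h2 : CongMod O (1 - q ^ (2 * (m : ℤ))) (poisedFactor q (2 * d * (R * m + s : ℕ) + t))
      (poisedFactor q (2 * d * s + t)) :=
    h.poisedFactor_cong ⟨d * R, by push_cast; ring⟩
  have h3 := (CongMod.mul (h.poisedFactor_mem _)
    (O.pow_mem (h.symmSqRatio_zero_mem hd hmd t s) 2) h2
    (h1.1.pow h1.2 (h.symmSqRatio_zero_mem hd hmd t s) 2)).mul_left
    (O.pow_mem (h.symmSqRatio_zero_mem hd hmd t (R * m)) 2)
  have e : symmSqRatio q d t 0 (R * m + s) = symmSqRatio q d t 0 (R * m) *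
      ∏ j ∈ Finset.range s, (symmSq q (t + d * ((R * m + j : ℕ) : ℤ)) - 0) /
        (symmSq q (d * ((R * m + j + 1 : ℕ) : ℤ)) - 0) := Finset.prod_range_add _ _ _
  rw [coreTerm, coreTerm, e]
  convert h3 using 1
  ring

theorem sum_coreTerm_block (hd : 0 < d) (hmd : IsCoprime (m : ℤ) d) {s : ℕ} (hsm : s < m)
    (hs : (m : ℤ) ∣ t + d * (s : ℤ)) {l : ℕ} (hsl : s < l) (hl : l ≤ m) (R : ℕ) :
    CongMod O (1 - q ^ (2 * (m : ℤ)))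
      (∑ j ∈ Finset.range l, coreTerm q d t (R * m + j)) 0 := by
  have h1 : CongMod O (1 - q ^ (2 * (m : ℤ))) (∑ j ∈ Finset.range l, coreTerm q d t j) 0 := by
    obtain ⟨i, rfl⟩ : ∃ i, l = s + 1 + i := ⟨l - (s + 1), by omega⟩
    rw [Finset.sum_range_add, ← add_zero (0 : K)]
    refine (h.sum_coreTerm_reflect hd hmd hsm hs).add (CongMod.sum_zero fun j hj => ?_)
    have := Finset.mem_range.mp hj
    obtain ⟨c, hc, e⟩ := h.coreTerm_cong_zero_of_lt hmd hs (k := s + 1 + j) (by omega) (by omega)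
    refine ⟨(1 - q ^ (2 * (m : ℤ))) ^ 3 * c,
      O.mul_mem (O.pow_mem (h.one_sub_mem _) 3) hc, ?_⟩
    rw [e]
    ring
  refine (CongMod.sum fun j hj => h.coreTerm_block hd hmd t R
    ((Finset.mem_range.mp hj).trans_le hl)).trans ?_
  rw [← Finset.mul_sum]
  exact h1.mul_left_zero (O.pow_mem (h.symmSqRatio_zero_mem hd hmd t (R * m)) 2)

theorem sum_coreTerm_mul (hd : 0 < d) (hmd : IsCoprime (m : ℤ) d) (t : ℤ) (R : ℕ) :
    CongMod O (1 - q ^ (2 * (m : ℤ))) (∑ k ∈ Finset.range (R * m), coreTerm q d t k) 0 := by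
  obtain ⟨s, hsm, hs⟩ := exists_dvd_add_mul (by have := h.one_lt; omega) hmd t
  induction R with
  | zero => simpa using CongMod.refl _
  | succ R ih =>
    rw [Nat.succ_mul, Finset.sum_range_add, ← add_zero (0 : K)]
    exact ih.add (h.sum_coreTerm_block hd hmd hsm hs hsm le_rfl R)

/-- The last, partial block ends exactly at the index `s = N % m`, which is the centre-doubling
index of the reflection. -/
theorem sum_coreTerm_of_dvd (hd : 0 < d) (hmd : IsCoprime (m : ℤ) d) {N : ℕ}
    (hN : (m : ℤ) ∣ t + d * (N : ℤ)) :
    CongMod O (1 - q ^ (2 * (m : ℤ))) (∑ k ∈ Finset.range (N + 1), coreTerm q d t k) 0 := by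
  have hm : 0 < m := by have := h.one_lt; omega
  have hs : (m : ℤ) ∣ t + d * ((N % m : ℕ) : ℤ) := by
    have e : t + d * (N : ℤ) = t + d * ((N % m : ℕ) : ℤ) + m * (d * (N / m : ℕ)) := by
      have : (N : ℤ) = (N % m : ℕ) + m * (N / m : ℕ) := by exact_mod_cast (Nat.mod_add_div N m).symm
      linear_combination (d : ℤ) * this
    rw [e] at hN
    exact (dvd_add_left (Dvd.intro _ rfl)).mp hN
  have := (h.sum_coreTerm_mul hd hmd t (N / m)).add
    (h.sum_coreTerm_block hd hmd (Nat.mod_lt _ hm) hs (Nat.lt_succ_self _) (Nat.mod_lt _ hm) (N / m))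
  rwa [← Finset.sum_range_add, add_zero, Nat.succ_eq_add_one, ← add_assoc, mul_comm (N / m),
    Nat.div_add_mod] at this

end IsCyclotomicLocal

/-! ### Deformation modulo the cube -/

namespace IsCyclotomicLocal

variable {K : Type*} [Field K] {O : Subring K} {q : K} {m n d N : ℕ} {t : ℤ}

theorem not_dvd_add_self {L : ℤ} (hL : ¬ (n : ℤ) ∣ L) : ¬ (n : ℤ) ∣ L + n ∧ ¬ (n : ℤ) ∣ L - n :=
  ⟨fun h' => hL ((dvd_add_left dvd_rfl).mp h'), fun h' => hL ((dvd_sub_left dvd_rfl).mp h')⟩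

theorem ne_zero_of_not_dvd {L : ℤ} (hL : ¬ (n : ℤ) ∣ L) : L ≠ 0 := fun h0 => hL (h0 ▸ dvd_zero _)

section Deformation

/-- The factor by which replacing `σ(L)` with `σ(L) - σ(n)`, where `σ = symmSq q`,
changes `σ(L)`. -/
def deformFactor (q : K) (n : ℕ) (L : ℤ) : K := (symmSq q L - symmSq q n) / symmSq q L

variable (h : IsCyclotomicLocal O q n)
include h

theorem deformFactor_mem {L : ℤ} (hL : ¬ (n : ℤ) ∣ L) : deformFactor q n L ∈ O := by
  rw [deformFactor, div_eq_mul_inv]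
  exact O.mul_mem (O.sub_mem (h.symmSq_mem _) (h.symmSq_mem _)) (h.symmSq_inv_mem hL)

theorem deformFactor_inv_mem {L : ℤ} (hL : ¬ (n : ℤ) ∣ L) : (deformFactor q n L)⁻¹ ∈ O := by
  rw [deformFactor, inv_div, div_eq_mul_inv, h.symmSq_sub_symmSq, mul_inv, mul_inv, inv_inv]
  exact O.mul_mem (h.symmSq_mem _) (O.mul_mem (O.mul_mem
    (h.one_sub_inv_mem _ (not_dvd_add_self hL).1)
    (h.one_sub_inv_mem _ (not_dvd_add_self hL).2)) (h.zpow_mem _))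

theorem deformFactor_ne_zero {L : ℤ} (hL : ¬ (n : ℤ) ∣ L) : deformFactor q n L ≠ 0 := by
  have h1 := ne_zero_of_not_dvd (not_dvd_add_self hL).1
  have h2 := ne_zero_of_not_dvd (not_dvd_add_self hL).2
  rw [deformFactor, h.symmSq_sub_symmSq]
  exact div_ne_zero (mul_ne_zero (mul_ne_zero (h.one_sub_ne_zero (by omega))
    (h.one_sub_ne_zero (by omega))) (inv_ne_zero (h.zpow_ne_zero' _)))
    (h.symmSq_ne_zero (ne_zero_of_not_dvd hL))

theorem deformFactor_eq {L : ℤ} (hL : ¬ (n : ℤ) ∣ L) :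
    deformFactor q n L = 1 - symmSq q n * (symmSq q L)⁻¹ := by
  have := h.symmSq_ne_zero (ne_zero_of_not_dvd hL)
  rw [deformFactor]
  field_simp

theorem deformFactor_cong_one {L : ℤ} (hL : ¬ (n : ℤ) ∣ L) :
    CongMod O ((1 - q ^ (2 * (n : ℤ))) ^ 2) (deformFactor q n L) 1 := by
  have := (CongMod.refl 1).sub
    ((h.symmSq_cong_zero (dvd_refl (n : ℤ))).mul_left_zero (h.symmSq_inv_mem hL))
  rwa [sub_zero, mul_comm _⁻¹, ← h.deformFactor_eq hL] at this

/-- In `1 - σ(n) / σ(L)`, `σ(n)` supplies two powers of the generator and the difference of the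
inverses a third. -/
theorem deformFactor_cong {L L' : ℤ} (hL : ¬ (n : ℤ) ∣ L) (hL' : ¬ (n : ℤ) ∣ L')
    (hLL : (n : ℤ) ∣ L - L') :
    CongMod O ((1 - q ^ (2 * (n : ℤ))) ^ 3) (deformFactor q n L) (deformFactor q n L') := by
  have h1 := (h.symmSq_cong hLL).inv (h.symmSq_ne_zero (ne_zero_of_not_dvd hL))
    (h.symmSq_ne_zero (ne_zero_of_not_dvd hL')) (h.symmSq_inv_mem hL) (h.symmSq_inv_mem hL')
  have h2 := ((h.symmSq_cong_zero (dvd_refl (n : ℤ))).mul_zero_mul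
    (CongMod.sub_zero_iff.mpr h1)).mul_left_zero (O.neg_mem O.one_mem)
  rw [← pow_succ] at h2
  rw [← CongMod.sub_zero_iff, h.deformFactor_eq hL, h.deformFactor_eq hL']
  convert h2 using 1
  ring

/-- Modulo `(1 - q ^ (2 n)) ^ 3`, the sum does not change if half of the factors `σ(L)` are
replaced by `σ(L) - σ(n)`, where `σ = symmSq q`. -/
theorem sum_coreTerm_cong_deformed (hd : 0 < d) (hnd : IsCoprime (n : ℤ) d)
    (htd : ¬ (d : ℤ) ∣ t) (hN : t + d * (N : ℤ) = n) (hNn : N < n) :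
    CongMod O ((1 - q ^ (2 * (n : ℤ))) ^ 3) (∑ k ∈ Finset.range (N + 1), coreTerm q d t k)
      (∑ k ∈ Finset.range (N + 1), poisedFactor q (2 * d * k + t) * symmSqRatio q d t 0 k *
        symmSqRatio q d t (symmSq q n) k) := by
  have hnum : ∀ j < N, ¬ (n : ℤ) ∣ t + d * (j : ℤ) := by
    intro j hj hj'
    have h1 := not_dvd_mul hnd (i := N - j) (by omega) (by omega)
    refine h1 ?_
    rw [Nat.cast_sub hj.le, mul_sub]
    have : (d * N - d * j : ℤ) = n - (t + d * j) := by linear_combination hN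
    rw [this]
    exact dvd_sub dvd_rfl hj'
  have hden : ∀ i, 1 ≤ i → i ≤ N → ¬ (n : ℤ) ∣ d * (i : ℤ) := fun i h1 h2 =>
    not_dvd_mul hnd h1 (by omega)
  have htj : ∀ j : ℕ, t + d * (j : ℤ) ≠ 0 := fun j hj =>
    htd ⟨-j, by linear_combination hj⟩
  obtain ⟨ρ, hρ⟩ : ∃ ρ : ℕ → K, ∀ k, ρ k = ∏ j ∈ Finset.range k,
    deformFactor q n (t + d * (j : ℤ)) / deformFactor q n (d * ((j + 1 : ℕ) : ℤ)) :=
    ⟨_, fun _ => rfl⟩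
  have hρδ : ∀ k, symmSqRatio q d t (symmSq q n) k = symmSqRatio q d t 0 k * ρ k := by
    intro k
    rw [hρ, symmSqRatio, symmSqRatio, ← Finset.prod_mul_distrib]
    refine Finset.prod_congr rfl fun j _ => ?_
    have h1 := h.symmSq_ne_zero (htj j)
    have h2 := h.symmSq_ne_zero (L := d * ((j + 1 : ℕ) : ℤ)) (by positivity)
    rw [deformFactor, deformFactor, sub_zero, sub_zero, div_div_div_eq]
    field_simp
  have hρmem : ∀ k ≤ N, ∀ j ∈ Finset.range k, deformFactor q n (t + d * (j : ℤ)) /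
      deformFactor q n (d * ((j + 1 : ℕ) : ℤ)) ∈ O := by
    intro k hk j hj
    have := Finset.mem_range.mp hj
    rw [div_eq_mul_inv]
    exact O.mul_mem (h.deformFactor_mem (hnum j (by omega)))
      (h.deformFactor_inv_mem (hden _ (by omega) (by omega)))
  have hρ1 : ∀ k ≤ N, CongMod O ((1 - q ^ (2 * (n : ℤ))) ^ 2) (1 - ρ k) 0 := by
    intro k hk
    rw [CongMod.sub_zero_iff]
    refine CongMod.symm ?_
    rw [hρ]
    refine CongMod.trans (CongMod.prod (g := fun _ => 1) (hρmem k hk) (fun _ _ => O.one_mem)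
      fun j hj => ?_) (CongMod.of_eq Finset.prod_const_one)
    have := Finset.mem_range.mp hj
    have hj1 := hden (j + 1) (by omega) (by omega)
    have := CongMod.mul (h.deformFactor_mem (hnum j (by omega))) (by simp)
      (h.deformFactor_cong_one (hnum j (by omega)))
      ((h.deformFactor_cong_one hj1).inv (h.deformFactor_ne_zero hj1) one_ne_zero
        (h.deformFactor_inv_mem hj1) (by simp))
    rwa [inv_one, mul_one, ← div_eq_mul_inv] at this
  have hρs : ∀ k ≤ N, CongMod O ((1 - q ^ (2 * (n : ℤ))) ^ 3) (ρ k) (ρ (N - k)) := by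
    intro k hk
    rw [hρ, hρ]
    refine CongMod.prod_div_symm (u := fun i : ℕ => deformFactor q n (d * (i : ℤ)))
      (f := fun j : ℕ => deformFactor q n (t + d * (j : ℤ)))
      (fun i h1 h2 => h.deformFactor_ne_zero (hden i h1 h2))
      (fun i h1 h2 => h.deformFactor_mem (hden i h1 h2))
      (fun i h1 h2 => h.deformFactor_inv_mem (hden i h1 h2))
      (fun j hj => h.deformFactor_mem (hnum j hj)) (fun j hj => ?_) hk
    have e : deformFactor q n (t + d * (j : ℤ)) = deformFactor q n (-(t + d * (j : ℤ))) := by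
      rw [deformFactor, deformFactor, symmSq_neg]
    rw [e]
    refine h.deformFactor_cong (by rw [Int.dvd_neg]; exact hnum j hj)
      (hden _ (by omega) (by omega)) ⟨-1, ?_⟩
    rw [Nat.cast_sub hj.le]
    linear_combination -hN
  rw [← CongMod.sub_zero_iff, ← Finset.sum_sub_distrib]
  -- With `c` the core term, `c_k (1 - ρ_k) + c_{N-k} (1 - ρ_{N-k})` equals `(c_k + c_{N-k})(1 -
  -- ρ_k) + c_{N-k} (ρ_k - ρ_{N-k})`. The first product has order `1 + 2`, the second order `3`.
  refine CongMod.sum_range_antisymm h.two_inv_mem h.two_ne_zero fun k hk => ?_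
  have h1 := (h.coreTerm_add_reflect hd hnd hNn (dvd_of_eq hN.symm) hk).mul_zero_mul (hρ1 k hk)
  have h2 := (CongMod.sub_zero_iff.mpr (hρs k hk)).mul_left_zero
    (h.coreTerm_mem hd hnd t (N - k))
  rw [← pow_succ'] at h1
  have h3 := h1.add h2
  rw [add_zero] at h3
  convert h3 using 1
  rw [hρδ, hρδ, coreTerm, coreTerm]
  ring

end Deformation

/-! ### Integrality and vanishing of the closed form -/

section ClosedForm

/-- The quotient of `q`-shifted factorials in the closed form. -/
def closedFormRatio (q : K) (d : ℕ) (t : ℤ) (N : ℕ) : K :=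
  qPoch (q ^ (4 * t)) (q ^ (2 * d)) N / ((1 + q ^ (2 * t)) * qPoch (q ^ (2 * d)) (q ^ (2 * d)) N)

theorem qPoch_self_eq (q : K) (d M : ℕ) : qPoch (q ^ (2 * d)) (q ^ (2 * d)) M =
    ∏ j ∈ Finset.range M, (1 - q ^ (2 * (d * ((j + 1 : ℕ) : ℤ)))) := by
  refine Finset.prod_congr rfl fun j _ => ?_
  rw [← pow_mul, ← pow_add, ← zpow_natCast]
  congr 2
  push_cast
  ring

theorem qInt_sq_eq (q : K) (n : ℕ) : qInt (q ^ 2) n = (1 - q ^ (2 * (n : ℤ))) * (1 - q ^ 2)⁻¹ := by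
  rw [qInt, div_eq_mul_inv, ← zpow_natCast q 2, ← zpow_mul]
  rfl

theorem closedForm_eq (q : K) (n d : ℕ) (t : ℤ) (N : ℕ) : closedForm q n d t N =
    -2 * qInt q t ^ 2 * qInt (q ^ 2) n * closedFormRatio q d t N * q ^ (t - 2 * t * N) := by
  rw [closedForm, closedFormRatio, mul_div_assoc]

variable (h : IsCyclotomicLocal O q m)
include h

theorem div_one_sub_mem' {L L' : ℤ} (hL : (m : ℤ) ∣ L' → (m : ℤ) ∣ L) (h0 : L' ≠ 0) :
    (1 - q ^ (2 * L)) / (1 - q ^ (2 * L')) ∈ O := by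
  by_cases hm : (m : ℤ) ∣ L'
  · exact h.div_mem (hL hm) hm h0
  · rw [div_eq_mul_inv]
    exact O.mul_mem (h.one_sub_mem _) (h.one_sub_inv_mem _ hm)

theorem qPoch_zpow_eq (B : ℤ) (M : ℕ) : qPoch (q ^ (2 * B)) (q ^ (2 * d)) M =
    ∏ j ∈ Finset.range M, (1 - q ^ (2 * (B + d * (j : ℤ)))) := by
  refine Finset.prod_congr rfl fun j _ => ?_
  rw [← pow_mul, ← zpow_natCast, ← zpow_add₀ h.ne_zero]
  congr 2
  push_cast
  ring

theorem one_add_zpow_eq (ht : t ≠ 0) :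
    1 + q ^ (2 * t) = (1 - q ^ (2 * (2 * t))) / (1 - q ^ (2 * t)) := by
  rw [eq_div_iff (h.one_sub_ne_zero (by omega)), show 2 * (2 * t) = 2 * t + 2 * t by ring,
    zpow_add₀ h.ne_zero]
  ring

theorem one_add_zpow_ne_zero (ht : t ≠ 0) : 1 + q ^ (2 * t) ≠ 0 := by
  rw [h.one_add_zpow_eq ht]
  exact div_ne_zero (h.one_sub_ne_zero (by omega)) (h.one_sub_ne_zero (by omega))

/-- The danger is `1 + q^(2t)`, which may be a non-unit when `m ∣ 2t`. Then, if `N > 0`, the first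
numerator cancels it, leaving `1 - q^(2t)`. This pairs with the last denominator `1 - q^(2dN)`,
since `m ∣ dN` forces `m ∣ t`; every other denominator pairs with the numerator whose exponent
exceeds its own by `4t`. -/
theorem closedFormRatio_mem (hd : 0 < d) (hmd : IsCoprime (m : ℤ) d) (ht : t ≠ 0)
    (hN : (m : ℤ) ∣ t + d * (N : ℤ)) : closedFormRatio q d t N ∈ O := by
  rw [closedFormRatio, show 4 * t = 2 * (2 * t) by ring]
  by_cases h2t : (m : ℤ) ∣ 2 * t
  · rcases N with _ | N
    · rw [qPoch_zero, qPoch_zero, mul_one, h.one_add_zpow_eq ht, one_div_div]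
      exact h.div_one_sub_mem' (fun _ => by simpa using hN) (by omega)
    · rw [qPoch_succ', mul_comm (1 + _), qPoch_self_eq q d, Finset.prod_range_succ,
        show q ^ (2 * (2 * t)) * q ^ (2 * d) = q ^ (2 * (2 * t + d)) by
          rw [← zpow_natCast, ← zpow_add₀ h.ne_zero]; congr 1; push_cast; ring,
        qPoch_zpow_eq h]
      have e : (1 - q ^ (2 * (2 * t))) / (1 + q ^ (2 * t)) = 1 - q ^ (2 * t) := by
        rw [div_eq_iff (h.one_add_zpow_ne_zero ht), show 2 * (2 * t) = 2 * t + 2 * t by ring,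
          zpow_add₀ h.ne_zero]
        ring
      rw [mul_comm (1 - _), mul_assoc, mul_div_mul_comm, mul_comm _ (1 + _), ← div_div, e,
        ← Finset.prod_div_distrib]
      refine O.mul_mem (O.prod_mem fun j _ => h.div_one_sub_mem' (fun hj => ?_) (by positivity))
        (h.div_one_sub_mem' (fun hj => (dvd_add_left hj).mp hN) (by positivity))
      rw [show 2 * t + d + d * (j : ℤ) = 2 * t + d * ((j + 1 : ℕ) : ℤ) by push_cast; ring]
      exact dvd_add h2t hj
  · rw [mul_comm (1 + _), ← div_div, qPoch_zpow_eq h, qPoch_self_eq q d, ← Finset.prod_div_distrib,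
      div_eq_mul_inv]
    refine O.mul_mem (h.prod_div_mem hd hmd _ N) ?_
    rw [h.one_add_zpow_eq ht, inv_div]
    exact h.div_one_sub_mem' (fun hj => absurd hj h2t) (by omega)

theorem one_sub_sq_inv_mem : (1 - q ^ 2)⁻¹ ∈ O := by
  have := h.one_sub_inv_mem 1 fun h1 => by
    have := Int.le_of_dvd one_pos h1
    have := h.one_lt
    omega
  exact_mod_cast this

theorem one_sub_self_ne_zero : 1 - q ≠ 0 := by
  simpa using h.one_sub_ne_zero (L := 1) one_ne_zero

theorem one_sub_self_inv_mem : (1 - q)⁻¹ ∈ O := by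
  have h1 := h.one_sub_self_ne_zero
  have h2 : 1 - q ^ 2 ≠ 0 := by
    have := h.one_sub_ne_zero (L := 2) (by norm_num)
    exact_mod_cast this
  have e : (1 - q)⁻¹ = (1 + q) * (1 - q ^ 2)⁻¹ := by
    field_simp
    ring
  rw [e]
  exact O.mul_mem (O.add_mem O.one_mem h.mem) h.one_sub_sq_inv_mem

theorem coeff_mem (t : ℤ) : q ^ (2 * t) / ((1 - q ^ 2) * (1 - q) ^ 2) ∈ O := by
  rw [div_eq_mul_inv, mul_inv, ← inv_pow]
  exact O.mul_mem (h.zpow_mem _)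
    (O.mul_mem h.one_sub_sq_inv_mem (O.pow_mem h.one_sub_self_inv_mem 2))

theorem closedForm_cong_zero (hd : 0 < d) (hmd : IsCoprime (m : ℤ) d) (ht : t ≠ 0)
    (hN : t + d * (N : ℤ) = n) (hmn : (m : ℤ) ∣ n) :
    CongMod O (1 - q ^ (2 * (m : ℤ))) (closedForm q n d t N) 0 := by
  rw [closedForm_eq, qInt_sq_eq q, qInt, div_eq_mul_inv]
  have h1 := (h.one_sub_cong_zero hmn).mul_left_zero (O.mul_mem (O.mul_mem (O.mul_mem
    (O.mul_mem (O.neg_mem (by exact_mod_cast natCast_mem O 2 : (2 : K) ∈ O))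
      (O.pow_mem (O.mul_mem (h.one_sub_mem t) h.one_sub_self_inv_mem) 2))
    h.one_sub_sq_inv_mem) (h.closedFormRatio_mem (N := N) hd hmd ht (hN ▸ hmn)))
    (h.zpow_mem (t - 2 * t * N)))
  convert h1 using 1
  ring

end ClosedForm

end IsCyclotomicLocal

/-! ### Local congruences for the original sum -/

namespace IsCyclotomicLocal

variable {K : Type*} [Field K] {O : Subring K} {q : K} {m n d N : ℕ} {t : ℤ}

theorem sum_summand_eq (hq : q ≠ 0) (d : ℕ) (t : ℤ) (s : Finset ℕ) :
    ∑ k ∈ s, summand q d t k =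
      q ^ (2 * t) / ((1 - q ^ 2) * (1 - q) ^ 2) * ∑ k ∈ s, coreTerm q d t k := by
  rw [Finset.mul_sum]
  exact Finset.sum_congr rfl fun k _ => summand_eq hq d t k

theorem sum_summand_cong_zero (h : IsCyclotomicLocal O q m) (hd : 0 < d)
    (hmd : IsCoprime (m : ℤ) d) (hN : (m : ℤ) ∣ t + d * (N : ℤ)) :
    CongMod O (1 - q ^ (2 * (m : ℤ))) (∑ k ∈ Finset.range (N + 1), summand q d t k) 0 := by
  rw [sum_summand_eq h.ne_zero]
  exact (h.sum_coreTerm_of_dvd hd hmd hN).mul_left_zero (h.coeff_mem t)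

theorem sum_summand_mul_cong_zero (h : IsCyclotomicLocal O q m) (hd : 0 < d)
    (hmd : IsCoprime (m : ℤ) d) (t : ℤ) (hmn : m ∣ n) :
    CongMod O (1 - q ^ (2 * (m : ℤ))) (∑ k ∈ Finset.range n, summand q d t k) 0 := by
  obtain ⟨R, rfl⟩ := hmn
  rw [sum_summand_eq h.ne_zero, mul_comm m]
  exact (h.sum_coreTerm_mul hd hmd t R).mul_left_zero (h.coeff_mem t)

/-- This is `sum_symmRatio` at `s = q^t`, `P = q^(2d)`, where `s^2 P^N = q^(2n)`; `d ∤ t` keeps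
every denominator non-zero. -/
theorem coeff_mul_sum_deformed (h : IsCyclotomicLocal O q n) (hd : 0 < d)
    (htd : ¬ (d : ℤ) ∣ t) (hN : t + d * (N : ℤ) = n) :
    q ^ (2 * t) / ((1 - q ^ 2) * (1 - q) ^ 2) * (∑ k ∈ Finset.range (N + 1),
        poisedFactor q (2 * d * k + t) * symmSqRatio q d t 0 k *
          symmSqRatio q d t (symmSq q n) k) =
      closedForm q n d t N + (1 - q ^ (2 * (n : ℤ))) ^ 3 *
        (q ^ (2 * t) * (q ^ (2 * (n : ℤ)))⁻¹ * q ^ (-(2 * t * N)) * (1 - q ^ 2)⁻¹ *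
          (1 - q)⁻¹ ^ 2 * closedFormRatio q d t N) := by
  have ht : t ≠ 0 := fun ht => htd (ht ▸ dvd_zero _)
  have hq := h.ne_zero
  have es : (q ^ t) ^ 2 = q ^ (2 * t) := by rw [mul_comm, zpow_mul]; norm_cast
  have es4 : (q ^ t) ^ 4 = q ^ (4 * t) := by rw [mul_comm, zpow_mul]; norm_cast
  have ePk : ∀ k : ℕ, (q ^ (2 * d)) ^ k = q ^ (2 * (d * (k : ℤ))) := fun k => by
    rw [← pow_mul, ← zpow_natCast]
    congr 1
    push_cast
    ring
  have eu : ∀ k : ℕ, q ^ (2 * t) * q ^ (2 * (d * (k : ℤ))) = q ^ (2 * (t + d * (k : ℤ))) :=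
    fun k => by rw [← zpow_add₀ hq]; congr 1; ring
  have key := sum_symmRatio (s := q ^ t) (P := q ^ (2 * d)) (h.zpow_ne_zero' t)
    (pow_ne_zero _ hq) (fun j => ?_) (fun j => ?_) (fun i j => ?_) ?_ N
  rotate_left
  · rw [ePk]
    exact h.zpow_ne_one _ (by positivity)
  · rw [es, ePk, eu]
    exact h.zpow_ne_one _ fun hj => htd ⟨-j, by linarith⟩
  · rw [es, ePk, ePk, eu]
    intro hij
    refine h.zpow_ne_one (2 * (t + d * (j : ℤ)) - 2 * (d * (i : ℤ))) (fun hj => htd ⟨i - j, ?_⟩) ?_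
    · linarith
    · rw [zpow_sub₀ hq, ← hij, div_self (h.zpow_ne_zero' _)]
  · rw [es]
    exact h.one_add_zpow_ne_zero ht
  rw [es, es4, ePk N, eu, hN, show q ^ (2 * (n : ℤ)) + (q ^ (2 * (n : ℤ)))⁻¹ = 2 + symmSq q n by
    rw [symmSq]; ring] at key
  have hterm : ∀ k : ℕ, (1 - (q ^ t * (q ^ (2 * d)) ^ k) ^ 2) * (1 - q ^ t * (q ^ (2 * d)) ^ k) ^ 2 /
      ((q ^ (2 * d)) ^ k) ^ 2 * symmRatio (q ^ (2 * t)) (q ^ (2 * d)) 2 k *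
        symmRatio (q ^ (2 * t)) (q ^ (2 * d)) (2 + symmSq q n) k =
      q ^ (2 * t) * (poisedFactor q (2 * d * k + t) * symmSqRatio q d t 0 k *
        symmSqRatio q d t (symmSq q n) k) := by
    intro k
    have e0 := symmRatio_eq_symmSqRatio hq d t 0 k
    rw [add_zero] at e0
    have e1 : q ^ t * q ^ (2 * (d * (k : ℤ))) = q ^ (2 * d * k + t : ℤ) := by
      rw [← zpow_add₀ hq]
      congr 1
      ring
    have e2 : (q ^ (2 * d * k + t : ℤ)) ^ 2 = q ^ (2 * (2 * d * k + t : ℤ)) := by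
      rw [mul_comm 2 (2 * d * k + t : ℤ), zpow_mul]
      norm_cast
    have e3 : ((q ^ (2 * (d * (k : ℤ)))) ^ 2)⁻¹ =
        q ^ (2 * t) * (q ^ (2 * (2 * d * k + t : ℤ)))⁻¹ := by
      rw [← zpow_natCast, ← zpow_mul, ← zpow_neg, ← zpow_neg, ← zpow_add₀ hq]
      congr 1
      push_cast
      ring
    rw [e0, symmRatio_eq_symmSqRatio hq, ePk, e1, e2, div_eq_mul_inv, e3, poisedFactor]
    ring
  simp only [hterm] at key
  rw [← Finset.mul_sum, ← closedFormRatio] at key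
  rw [div_mul_eq_mul_div, key, closedForm_eq, qInt_sq_eq, qInt]
  have e5 : (q ^ (2 * t))⁻¹ ^ N = q ^ (-(2 * t * N)) := by
    rw [← zpow_neg, ← zpow_natCast, ← zpow_mul]
    congr 1
    ring
  rw [e5, sub_eq_add_neg t, zpow_add₀ hq]
  simp only [div_eq_mul_inv, mul_inv, mul_pow, ← inv_pow]
  ring

/-- The congruence of the truncated sum and the closed form modulo `(1 - q ^ (2 n)) ^ 3`. -/
theorem sum_summand_cong_closedForm (h : IsCyclotomicLocal O q n) (hd : 0 < d)
    (hnd : IsCoprime (n : ℤ) d) (htd : ¬ (d : ℤ) ∣ t) (hN : t + d * (N : ℤ) = n) (hNn : N < n) :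
    CongMod O ((1 - q ^ (2 * (n : ℤ))) ^ 3) (∑ k ∈ Finset.range (N + 1), summand q d t k)
      (closedForm q n d t N) := by
  have ht : t ≠ 0 := fun ht => htd (ht ▸ dvd_zero _)
  have h1 := (h.sum_coreTerm_cong_deformed hd hnd htd hN hNn).mul_left (h.coeff_mem t)
  rw [h.coeff_mul_sum_deformed hd htd hN, ← sum_summand_eq h.ne_zero] at h1
  refine h1.trans ⟨_, ?_, add_sub_cancel_left _ _⟩
  exact O.mul_mem (O.mul_mem (O.mul_mem (O.mul_mem (O.mul_mem (h.zpow_mem _) (h.zpow_inv_mem _))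
    (h.zpow_mem _)) h.one_sub_sq_inv_mem) (O.pow_mem h.one_sub_self_inv_mem 2))
    (h.closedFormRatio_mem hd hnd ht (dvd_of_eq hN.symm))

theorem sum_range_summand_cong_sum_range (h : IsCyclotomicLocal O q n)
    (hnd : IsCoprime (n : ℤ) d) (hN : t + d * (N : ℤ) = n) (hNn : N < n) :
    CongMod O ((1 - q ^ (2 * (n : ℤ))) ^ 3) (∑ k ∈ Finset.range n, summand q d t k)
      (∑ k ∈ Finset.range (N + 1), summand q d t k) := by
  rw [sum_summand_eq h.ne_zero, sum_summand_eq h.ne_zero]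
  refine CongMod.mul_left (h.coeff_mem t) ?_
  obtain ⟨i, hi⟩ : ∃ i, n = N + 1 + i := ⟨n - (N + 1), by omega⟩
  have h1 : CongMod O ((1 - q ^ (2 * (n : ℤ))) ^ 3)
      (∑ j ∈ Finset.range i, coreTerm q d t (N + 1 + j)) 0 := by
    refine CongMod.sum_zero fun j hj => ?_
    have := Finset.mem_range.mp hj
    obtain ⟨c, hc, e⟩ := h.coreTerm_cong_zero_of_lt hnd (dvd_of_eq hN.symm) (k := N + 1 + j)
      (by omega) (by omega)
    refine ⟨(1 - q ^ (2 * (n : ℤ))) * c, O.mul_mem (h.one_sub_mem _) hc, ?_⟩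
    rw [e]
    ring
  have h2 := (CongMod.refl (∑ k ∈ Finset.range (N + 1), coreTerm q d t k)).add h1
  rwa [← Finset.sum_range_add, ← hi, add_zero] at h2

end IsCyclotomicLocal

/-! ### The concrete localization, and from local to global -/

section Localization

/-- The localization of `ℚ[X]` at the polynomials that are relatively prime to `P`. -/
def polyLocalization (P : ℚ[X]) : Subring (RatFunc ℚ) where
  carrier := {x | ∃ u v : ℚ[X], v ≠ 0 ∧ IsCoprime v P ∧
    x = algebraMap ℚ[X] (RatFunc ℚ) u / algebraMap ℚ[X] (RatFunc ℚ) v}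
  one_mem' := ⟨1, 1, one_ne_zero, isCoprime_one_left, by simp⟩
  zero_mem' := ⟨0, 1, one_ne_zero, isCoprime_one_left, by simp⟩
  mul_mem' := by
    rintro _ _ ⟨u, v, hv, hvP, rfl⟩ ⟨u', v', hv', hvP', rfl⟩
    exact ⟨u * u', v * v', mul_ne_zero hv hv', hvP.mul_left hvP', by
      rw [map_mul, map_mul, div_mul_div_comm]⟩
  add_mem' := by
    rintro _ _ ⟨u, v, hv, hvP, rfl⟩ ⟨u', v', hv', hvP', rfl⟩
    refine ⟨u * v' + v * u', v * v', mul_ne_zero hv hv', hvP.mul_left hvP', ?_⟩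
    rw [div_add_div _ _ (RatFunc.algebraMap_ne_zero hv) (RatFunc.algebraMap_ne_zero hv')]
    simp only [map_mul, map_add]
  neg_mem' := by
    rintro _ ⟨u, v, hv, hvP, rfl⟩
    exact ⟨-u, v, hv, hvP, by rw [map_neg, neg_div]⟩

theorem algebraMap_mem_polyLocalization (P u : ℚ[X]) :
    algebraMap ℚ[X] (RatFunc ℚ) u ∈ polyLocalization P :=
  ⟨u, 1, one_ne_zero, isCoprime_one_left, by simp⟩

theorem algebraMap_inv_mem_polyLocalization {P v : ℚ[X]} (hv : v ≠ 0) (hvP : IsCoprime v P) :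
    (algebraMap ℚ[X] (RatFunc ℚ) v)⁻¹ ∈ polyLocalization P :=
  ⟨1, v, hv, hvP, by simp⟩

/-- `Φ_m(X ^ 2)`. -/
noncomputable def cyclotomicSq (m : ℕ) : ℚ[X] := (cyclotomic m ℚ).comp (X ^ 2)

/-- `Φ_m(X^2)` can be reducible, so coprimality is tested on its complex roots, the `z` whose square
is a primitive `m`-th root of unity. -/
theorem isCoprime_cyclotomicSq {m : ℕ} (hm : 0 < m) {v : ℚ[X]}
    (h : ∀ z : ℂ, IsPrimitiveRoot (z ^ 2) m → aeval z v ≠ 0) : IsCoprime v (cyclotomicSq m) := by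
  rw [isCoprime_iff_aeval_ne_zero_of_isAlgClosed ℚ ℂ]
  intro z
  by_cases hz : IsPrimitiveRoot (z ^ 2) m
  · exact Or.inl (h z hz)
  · refine Or.inr fun h0 => hz ?_
    have : NeZero (m : ℂ) := ⟨by exact_mod_cast hm.ne'⟩
    rw [← isRoot_cyclotomic_iff, IsRoot, ← map_cyclotomic m (algebraMap ℚ ℂ), eval_map_algebraMap]
    rw [cyclotomicSq, aeval_comp] at h0
    simpa using h0

theorem isCoprime_cyclotomicSq_of_ne {m n : ℕ} (h : m ≠ n) :
    IsCoprime (cyclotomicSq m) (cyclotomicSq n) :=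
  (cyclotomic.isCoprime_rat h).map (compRingHom (X ^ 2 : ℚ[X]))

theorem cyclotomicSq_dvd (m : ℕ) : cyclotomicSq m ∣ 1 - X ^ (2 * m) := by
  have := (map_dvd (compRingHom (X ^ 2 : ℚ[X])) (cyclotomic.dvd_X_pow_sub_one m ℚ))
  simp only [map_sub, map_pow, map_one, coe_compRingHom_apply, X_comp] at this
  rw [← neg_sub, dvd_neg, pow_mul]
  exact this

theorem RatFunc.X_zpow_ne_one {L : ℤ} (hL : L ≠ 0) : (RatFunc.X : RatFunc ℚ) ^ L ≠ 1 := by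
  have nat : ∀ n : ℕ, n ≠ 0 → (RatFunc.X : RatFunc ℚ) ^ n ≠ 1 := by
    intro n hn h
    rw [← RatFunc.algebraMap_X, ← map_pow, ← map_one (algebraMap ℚ[X] (RatFunc ℚ))] at h
    have := congrArg natDegree (RatFunc.algebraMap_injective ℚ h)
    rw [natDegree_X_pow, natDegree_one] at this
    exact hn this
  obtain ⟨n, rfl | rfl⟩ := L.eq_nat_or_neg
  · rw [zpow_natCast]
    exact nat n (by omega)
  · rw [zpow_neg, zpow_natCast, Ne, inv_eq_one]
    exact nat n (by omega)

theorem one_sub_X_zpow_neg (n : ℕ) : 1 - (RatFunc.X : RatFunc ℚ) ^ (2 * -(n : ℤ)) =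
    -(RatFunc.X ^ (2 * n))⁻¹ * (1 - RatFunc.X ^ (2 * n)) := by
  have : (RatFunc.X : RatFunc ℚ) ^ (2 * n) ≠ 0 := pow_ne_zero _ RatFunc.X_ne_zero
  rw [mul_neg, zpow_neg]
  norm_cast
  field_simp
  ring

theorem isCyclotomicLocal_polyLocalization {m : ℕ} (hm : 1 < m) :
    IsCyclotomicLocal (polyLocalization (cyclotomicSq m)) (RatFunc.X : RatFunc ℚ) m where
  one_lt := hm
  ne_zero := RatFunc.X_ne_zero
  mem := RatFunc.algebraMap_X (K := ℚ) ▸ algebraMap_mem_polyLocalization _ X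
  inv_mem := by
    rw [← RatFunc.algebraMap_X]
    refine algebraMap_inv_mem_polyLocalization X_ne_zero (isCoprime_cyclotomicSq (by omega) ?_)
    rintro z hz h0
    rw [aeval_X] at h0
    exact hz.ne_zero (by omega) (by rw [h0]; norm_num)
  zpow_ne_one _ hL := RatFunc.X_zpow_ne_one hL
  two_ne_zero := two_ne_zero
  two_inv_mem := by
    have := algebraMap_inv_mem_polyLocalization (P := cyclotomicSq m) (v := 2) two_ne_zero
      ⟨C 2⁻¹, 0, by rw [zero_mul, add_zero, ← C_ofNat, ← C_mul]; norm_num⟩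
    rwa [map_ofNat] at this
  one_sub_inv_mem := by
    have nat : ∀ n : ℕ, ¬ (m : ℤ) ∣ n →
        (1 - (RatFunc.X : RatFunc ℚ) ^ (2 * n))⁻¹ ∈ polyLocalization (cyclotomicSq m) := by
      intro n hn
      have hn0 : n ≠ 0 := by rintro rfl; simp at hn
      have e : (1 - (RatFunc.X : RatFunc ℚ) ^ (2 * n)) = algebraMap ℚ[X] _ (1 - X ^ (2 * n)) := by
        simp
      rw [e]
      refine algebraMap_inv_mem_polyLocalization (fun h0 => ?_)
        (isCoprime_cyclotomicSq (by omega) fun z hz h0 => hn ?_)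
      · refine RatFunc.X_zpow_ne_one (L := (2 * n : ℕ)) (by omega) ?_
        rw [h0, map_zero, sub_eq_zero] at e
        rw [zpow_natCast, ← e]
      · rw [map_sub, map_one, map_pow, aeval_X, sub_eq_zero, pow_mul] at h0
        exact_mod_cast hz.dvd_of_pow_eq_one n h0.symm
    intro L hL
    obtain ⟨n, rfl | rfl⟩ := L.eq_nat_or_neg
    · exact_mod_cast nat n hL
    · rw [one_sub_X_zpow_neg, mul_inv, inv_neg, inv_inv]
      refine Subring.mul_mem _ (Subring.neg_mem _ (Subring.pow_mem _ ?_ _)) (nat n ?_)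
      · exact RatFunc.algebraMap_X (K := ℚ) ▸ algebraMap_mem_polyLocalization _ X
      · rwa [Int.dvd_neg] at hL
  div_one_sub_mem := by
    have nat : ∀ r : ℕ, r ≠ 0 → (1 - (RatFunc.X : RatFunc ℚ) ^ (2 * m)) /
        (1 - RatFunc.X ^ (2 * (m * r))) ∈ polyLocalization (cyclotomicSq m) := by
      intro r hr
      have e0 : (1 - (RatFunc.X : RatFunc ℚ) ^ (2 * m)) ≠ 0 := by
        have := RatFunc.X_zpow_ne_one (L := (2 * m : ℕ)) (by omega)
        rw [zpow_natCast] at this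
        exact sub_ne_zero.mpr this.symm
      have e : (1 - (RatFunc.X : RatFunc ℚ) ^ (2 * m)) / (1 - RatFunc.X ^ (2 * (m * r))) =
          (algebraMap ℚ[X] _ (∑ i ∈ Finset.range r, (X ^ (2 * m)) ^ i))⁻¹ := by
        rw [← mul_assoc, pow_mul _ (2 * m) r, ← geom_sum_mul_neg _ r, map_sum]
        simp only [map_pow, RatFunc.algebraMap_X]
        rw [mul_comm (Finset.sum _ _), ← div_div, div_self e0, one_div]
      have hcop : IsCoprime (∑ i ∈ Finset.range r, ((X : ℚ[X]) ^ (2 * m)) ^ i)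
          (cyclotomicSq m) := by
        -- At such a root `z^(2m) = 1`, so the geometric sum takes the value `r`, which is non-zero.
        refine isCoprime_cyclotomicSq (by omega) fun z hz h0 => hr ?_
        rw [map_sum] at h0
        simp only [map_pow, aeval_X] at h0
        rw [pow_mul, hz.pow_eq_one] at h0
        simpa using h0
      rw [e]
      refine algebraMap_inv_mem_polyLocalization (fun h0 => ?_) hcop
      have h1 := congrArg (eval 1) h0
      rw [eval_finsetSum] at h1
      simp only [eval_pow, eval_X, one_pow, Finset.sum_const, Finset.card_range, eval_zero,
        nsmul_eq_mul, mul_one] at h1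
      exact hr (by exact_mod_cast h1)
    rintro L ⟨c, rfl⟩ hL
    obtain ⟨n, rfl | rfl⟩ := c.eq_nat_or_neg
    · have := nat n (by rintro rfl; simp at hL)
      exact_mod_cast this
    · have h1 := nat n (by rintro rfl; simp at hL)
      have h2 := one_sub_X_zpow_neg (m * n)
      rw [show (m : ℤ) * -(n : ℤ) = -((m * n : ℕ) : ℤ) by push_cast; ring, h2, mul_comm (-_),
        ← div_div, div_eq_mul_inv _ (-_), inv_neg, inv_inv]
      refine Subring.mul_mem _ (by exact_mod_cast h1) (Subring.neg_mem _ (Subring.pow_mem _ ?_ _))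
      exact RatFunc.algebraMap_X (K := ℚ) ▸ algebraMap_mem_polyLocalization _ X

/-- Passing to the numerator of the reduced fraction turns statements in different localizations
into divisibilities of one polynomial, which coprimality then combines. -/
theorem cyclotomicSq_pow_dvd_num {m j : ℕ} {A B : RatFunc ℚ}
    (h : CongMod (polyLocalization (cyclotomicSq m)) ((1 - RatFunc.X ^ (2 * (m : ℤ))) ^ j) A B) :
    cyclotomicSq m ^ j ∣ (A - B).num := by
  obtain ⟨_, ⟨u, v, hv, hvP, rfl⟩, e⟩ := h
  have e1 : (1 - (RatFunc.X : RatFunc ℚ) ^ (2 * (m : ℤ))) ^ j =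
      algebraMap ℚ[X] _ ((1 - X ^ (2 * m)) ^ j) := by
    rw [show (2 * (m : ℤ)) = ((2 * m : ℕ) : ℤ) by push_cast; ring, zpow_natCast]
    simp
  have hden : algebraMap ℚ[X] (RatFunc ℚ) (A - B).denom ≠ 0 :=
    RatFunc.algebraMap_ne_zero (A - B).denom_ne_zero
  rw [e1, ← RatFunc.num_div_denom (A - B), ← mul_div_assoc,
    div_eq_div_iff hden (RatFunc.algebraMap_ne_zero hv), ← map_mul, ← map_mul, ← map_mul] at e
  have e2 := RatFunc.algebraMap_injective ℚ e
  refine (hvP.symm.pow_left (m := j)).dvd_of_dvd_mul_right ?_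
  rw [e2, mul_assoc]
  exact (pow_dvd_pow_of_dvd (cyclotomicSq_dvd m) j).mul_right _

theorem QCongr.of_dvd_num {P : ℚ[X]} {A B : RatFunc ℚ} (h : P ∣ (A - B).num) : QCongr P A B := by
  obtain ⟨u, hu⟩ := h
  refine ⟨u, (A - B).denom, (A - B).denom_ne_zero, ?_, ?_⟩
  · exact (A - B).isCoprime_num_denom.symm.of_isCoprime_of_dvd_right ⟨u, hu⟩
  · rw [← hu, RatFunc.num_div_denom]

theorem qModulus_eq {n : ℕ} (hn : 1 < n) : qModulus n =
    (∏ m ∈ (n.divisors.erase 1).erase n, cyclotomicSq m) * cyclotomicSq n ^ 3 := by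
  have h1 : qIntSqPoly n = ∏ m ∈ n.divisors.erase 1, cyclotomicSq m := by
    have := congrArg (compRingHom (X ^ 2 : ℚ[X])) (prod_cyclotomic_eq_geom_sum (by omega : 0 < n) ℚ)
    rw [map_prod, map_sum] at this
    simp only [coe_compRingHom_apply, pow_comp, X_comp] at this
    exact this.symm
  have hmem : n ∈ n.divisors.erase 1 := by
    rw [Finset.mem_erase, Nat.mem_divisors]
    exact ⟨by omega, dvd_rfl, by omega⟩
  rw [qModulus, h1, ← Finset.mul_prod_erase _ _ hmem, ← cyclotomicSq]
  ring

/-- A congruence modulo `[n]_{q^2} Φ_n(q^2)^2` can be checked locally. -/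
theorem QCongr.of_congMod {n : ℕ} (hn : 1 < n) {A B : RatFunc ℚ}
    (h1 : ∀ m : ℕ, 1 < m → m ∣ n →
      CongMod (polyLocalization (cyclotomicSq m)) (1 - RatFunc.X ^ (2 * (m : ℤ))) A B)
    (h3 : CongMod (polyLocalization (cyclotomicSq n)) ((1 - RatFunc.X ^ (2 * (n : ℤ))) ^ 3) A B) :
    QCongr (qModulus n) A B := by
  refine QCongr.of_dvd_num ?_
  rw [qModulus_eq hn]
  refine IsCoprime.mul_dvd (IsCoprime.prod_left fun m hm => ?_)
    (Finset.prod_dvd_of_coprime (fun i _ j _ hij => isCoprime_cyclotomicSq_of_ne hij)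
      fun m hm => ?_) (cyclotomicSq_pow_dvd_num h3)
  · exact (isCoprime_cyclotomicSq_of_ne (Finset.ne_of_mem_erase hm)).pow_right
  · rw [Finset.mem_erase, Finset.mem_erase, Nat.mem_divisors] at hm
    have hm0 : m ≠ 0 := by rintro rfl; exact hm.2.2.2 (zero_dvd_iff.mp hm.2.2.1)
    have := h1 m (by omega) hm.2.2.1
    rw [← pow_one (1 - _)] at this
    simpa using cyclotomicSq_pow_dvd_num this

end Localization

/-! ### The main theorem -/

theorem theorem6 (n d : ℕ) (t : ℤ) (hn : 1 < n) (hd : 2 ≤ d)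
    (hgcd : Int.gcd t d = 1) (hmod : (n : ℤ) ≡ t [ZMOD d])
    (hlow : (n : ℤ) + d - n * d ≤ t) (hup : t ≤ n)
    (N : ℕ) (hN : (N : ℤ) = (n - t) / d) :
    QCongr (qModulus n)
        (∑ k ∈ Finset.range (N + 1), summand (RatFunc.X : RatFunc ℚ) d t k)
        (closedForm RatFunc.X n d t N) ∧
      QCongr (qModulus n)
        (∑ k ∈ Finset.range n, summand (RatFunc.X : RatFunc ℚ) d t k)
        (closedForm RatFunc.X n d t N) := by
  have hd0 : 0 < d := by omega
  have hN' : t + d * (N : ℤ) = n := by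
    have hdvd : (d : ℤ) ∣ n - t := hmod.symm.dvd
    rw [hN, Int.mul_ediv_cancel' hdvd]
    ring
  have htd' : IsCoprime t (d : ℤ) := Int.isCoprime_iff_gcd_eq_one.mpr hgcd
  have htd : ¬ (d : ℤ) ∣ t := fun hdt => by
    have := Int.isUnit_iff.mp (htd'.isUnit_of_dvd' hdt dvd_rfl)
    omega
  have ht : t ≠ 0 := fun ht => htd (ht ▸ dvd_zero _)
  have hnd : IsCoprime (n : ℤ) (d : ℤ) := by
    rw [← hN']
    exact htd'.add_mul_left_left _
  -- The lower bound on `t` says exactly `dN = n - t ≤ d(n - 1)`.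
  have hNn : N < n := by
    have h1 : (d : ℤ) * N ≤ d * (n - 1) := by linarith
    have := le_of_mul_le_mul_left h1 (by omega)
    omega
  have hmd : ∀ m : ℕ, m ∣ n → IsCoprime (m : ℤ) (d : ℤ) := fun m hm =>
    hnd.of_isCoprime_of_dvd_left (Int.natCast_dvd_natCast.mpr hm)
  have hn' := isCyclotomicLocal_polyLocalization hn
  have hcube := hn'.sum_summand_cong_closedForm hd0 hnd htd hN' hNn
  constructor
  · refine QCongr.of_congMod hn (fun m hm hmn => ?_) hcube
    have h := isCyclotomicLocal_polyLocalization hm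
    have hmn' : (m : ℤ) ∣ n := Int.natCast_dvd_natCast.mpr hmn
    exact (h.sum_summand_cong_zero hd0 (hmd m hmn) (hN' ▸ hmn')).trans
      (h.closedForm_cong_zero hd0 (hmd m hmn) ht hN' hmn').symm
  · refine QCongr.of_congMod hn (fun m hm hmn => ?_)
      ((hn'.sum_range_summand_cong_sum_range hnd hN' hNn).trans hcube)
    have h := isCyclotomicLocal_polyLocalization hm
    exact (h.sum_summand_mul_cong_zero hd0 (hmd m hmn) t hmn).trans
      (h.closedForm_cong_zero hd0 (hmd m hmn) ht hN' (Int.natCast_dvd_natCast.mpr hmn)).symm
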